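/- Let $d\ge 1$, let $\Omega\subset\mathbb R^d$ be a bounded domain with smooth boundary, and let $p\in(2,\infty)$, $q\in(1,\infty)$, $s\in(0,1)$, $\mu\ge 0$. Let $W^{1,p}_0(\Omega)$ be the closure of $C_c^\infty(\Omega)$ in $W^{1,p}(\Omega)$ (its elements being extended by $0$ to $\mathbb R^d$), let $W^{s,q}_0(\Omega)=\{u\in W^{s,q}(\mathbb R^d): u=0 \text{ a.e. on } \mathbb R^d\setminus\Omega\}$, and put $\mathcal W=W^{1,p}_0(\Omega)\cap W^{s,q}_0(\Omega)$ if $\mu>0$ and $\mathcal W=W^{1,p}_0(\Omega)$ if $\mu=0$. For $u,\varphi\in\mathcal W$ let $$\langle\mathcal A_\mu u,\varphi\rangle=\int_\Omega|\nabla u|^{p-2}\nabla u\cdot\nabla\varphi\,dx+\mu\int_{\mathbb R^d}\int_{\mathbb R^d}\frac{|u(x)-u(y)|^{q-2}(u(x)-u(y))(\varphi(x)-\varphi(y))}{|x-y|^{d+sq}}\,dx\,dy .$$ Let $\vec f=(f_1,\dots,f_d)$ with $f_i\in W^{1,\infty}(\mathbb R)$ and $f_i(0)=0$, and put $\langle\operatorname{div}\vec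 f(u),\varphi\rangle=-\int_\Omega \vec f(u)\cdot\nabla\varphi\,dx$. Let $\beta:\mathbb R\to\mathbb R$ be an increasing bijection with $\beta(0)=0$ that is locally $\alpha$-Hölder continuous for some $\alpha\in(0,1]$, such that for every $K>0$ there is $C_K>0$ with $\beta(t)-\beta(t')\ge C_K(t-t')$ whenever $-K\le t'\le t\le K$, and such that $|\beta(t)|\le c(1+|t|^{p-1})$ for all $t\in\mathbb R$ and some constant $c$. Define the operator $A$ in $L^1(\Omega)$ by $$A(v)=\mathcal A_\mu(\beta^{-1}(v))-\operatorname{div}\vec f(\beta^{-1}(v)),\qquad D(A)=\{v\in L^1(\Omega):\ \beta^{-1}(v)\in\mathcal W,\ A(v)\in L^1(\Omega)\},$$ where $A(v)=w\in L^1(\Omega)$ means that $\langle\mathcal A_\mu(\beta^{-1}(v)),\varphi\rangle-\langle\operatorname{div}\vec f(\beta^{-1}(v)),\varphi\rangle=\int_\Omega w\varphi\,dx$ for all $\varphi\in\mathcal W\cap L^\infty(\Omega)$. Then $A$ is accretive in $L^1(\Omega)$: for all $v_1,v_2\in D(A)$ there is a bounded linear functional $\ell$ on $L^1(\Omega)$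 with $\ell(v_1-v_2)=\|v_1-v_2\|_{L^1(\Omega)}^2=\|\ell\|^2$ and $\ell(A(v_1)-A(v_2))\ge 0$. Moreover, for all $u,v\in\mathcal W$ and $i=1,\dots,d$, one has $f_i(u)-f_i(v)\in W^{1,p}(\Omega)$ and $$\int_\Omega\partial_{x_i}\big(f_i(u)-f_i(v)\big)\,\operatorname{sgn}(u-v)\,dx=0,$$ where $\operatorname{sgn}(0)=0$. -/

import Mathlib

open MeasureTheory Filter Topology

noncomputable section

namespace MixedOp

/-- Bounded domain of `ℝ^d` (nonempty, open, connected) with `C^∞` boundary: near every boundary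
point, `Ω` is the negativity set of a smooth function whose differential does not vanish there. -/
structure IsSmoothBoundedDomain {d : ℕ} (Ω : Set (EuclideanSpace ℝ (Fin d))) : Prop where
  isOpen : IsOpen Ω
  isConnected : IsConnected Ω
  isBounded : Bornology.IsBounded Ω
  smooth_boundary : ∀ x₀ ∈ frontier Ω, ∃ (U : Set (EuclideanSpace ℝ (Fin d)))
    (ρ : EuclideanSpace ℝ (Fin d) → ℝ), IsOpen U ∧ x₀ ∈ U ∧
      ContDiffOn ℝ (⊤ : ℕ∞) ρ U ∧ fderiv ℝ ρ x₀ ≠ 0 ∧ Ω ∩ U = {x ∈ U | ρ x < 0}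

/-- `φ ∈ C_c^∞(Ω)`. -/
structure IsTestFunction {d : ℕ} (Ω : Set (EuclideanSpace ℝ (Fin d)))
    (φ : EuclideanSpace ℝ (Fin d) → ℝ) : Prop where
  contDiff : ContDiff ℝ (⊤ : ℕ∞) φ
  hasCompactSupport : HasCompactSupport φ
  tsupport_subset : tsupport φ ⊆ Ω

/-- Classical partial derivative `∂φ/∂x_i`. -/
def partialDeriv {d : ℕ} (i : Fin d) (φ : EuclideanSpace ℝ (Fin d) → ℝ)
    (x : EuclideanSpace ℝ (Fin d)) : ℝ :=
  fderiv ℝ φ x (EuclideanSpace.single i 1)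

/-- `g` is the weak derivative `∂u/∂x_i` on `Ω`. -/
structure HasWeakPartial {d : ℕ} (Ω : Set (EuclideanSpace ℝ (Fin d))) (i : Fin d)
    (u g : EuclideanSpace ℝ (Fin d) → ℝ) : Prop where
  locallyIntegrableOn : LocallyIntegrableOn u Ω
  locallyIntegrableOn_deriv : LocallyIntegrableOn g Ω
  integral_eq : ∀ φ, IsTestFunction Ω φ →
    ∫ x in Ω, u x * partialDeriv i φ x = -∫ x in Ω, g x * φ x

open Classical in
/-- The weak derivative `∂u/∂x_i` on `Ω` (unique a.e. on `Ω` if it exists; `0` otherwise). -/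
def weakPartial {d : ℕ} (Ω : Set (EuclideanSpace ℝ (Fin d))) (i : Fin d)
    (u : EuclideanSpace ℝ (Fin d) → ℝ) : EuclideanSpace ℝ (Fin d) → ℝ :=
  if h : ∃ g, HasWeakPartial Ω i u g then h.choose else 0

/-- The weak gradient `∇u` on `Ω`. -/
def weakGrad {d : ℕ} (Ω : Set (EuclideanSpace ℝ (Fin d)))
    (u : EuclideanSpace ℝ (Fin d) → ℝ) (x : EuclideanSpace ℝ (Fin d)) :
    EuclideanSpace ℝ (Fin d) :=
  WithLp.toLp 2 (fun i => weakPartial Ω i u x)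

/-- `u ∈ W^{1,p}(Ω)`. -/
structure MemW1 {d : ℕ} (Ω : Set (EuclideanSpace ℝ (Fin d))) (p : ℝ)
    (u : EuclideanSpace ℝ (Fin d) → ℝ) : Prop where
  memLp : MemLp u (ENNReal.ofReal p) (volume.restrict Ω)
  memLp_deriv : ∀ i, ∃ g, HasWeakPartial Ω i u g ∧
    MemLp g (ENNReal.ofReal p) (volume.restrict Ω)

/-- `u ∈ W_0^{1,p}(Ω)`, the closure of `C_c^∞(Ω)` in `W^{1,p}(Ω)`. -/
structure MemW10 {d : ℕ} (Ω : Set (EuclideanSpace ℝ (Fin d))) (p : ℝ)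
    (u : EuclideanSpace ℝ (Fin d) → ℝ) : Prop where
  memW1 : MemW1 Ω p u
  exists_approx : ∃ φ : ℕ → EuclideanSpace ℝ (Fin d) → ℝ,
    (∀ n, IsTestFunction Ω (φ n)) ∧
    Tendsto (fun n => eLpNorm (fun x => u x - φ n x) (ENNReal.ofReal p) (volume.restrict Ω))
      atTop (𝓝 0) ∧
    ∀ i, Tendsto (fun n => eLpNorm (fun x => weakPartial Ω i u x - partialDeriv i (φ n) x)
      (ENNReal.ofReal p) (volume.restrict Ω)) atTop (𝓝 0)

/-- `u ∈ W_0^{s,q}(Ω)`: `u ∈ W^{s,q}(ℝ^d)` and `u = 0` a.e. outside `Ω`. -/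
structure MemWs0 {d : ℕ} (Ω : Set (EuclideanSpace ℝ (Fin d))) (s q : ℝ)
    (u : EuclideanSpace ℝ (Fin d) → ℝ) : Prop where
  memLp : MemLp u (ENNReal.ofReal q)
  seminorm_lt_top : ∫⁻ z : EuclideanSpace ℝ (Fin d) × EuclideanSpace ℝ (Fin d),
    ENNReal.ofReal (|u z.1 - u z.2| ^ q / ‖z.1 - z.2‖ ^ ((d : ℝ) + s * q)) < ⊤
  ae_eq_zero : ∀ᵐ x ∂(volume.restrict Ωᶜ), u x = 0

/-- The energy space `𝒲`: `W_0^{1,p}(Ω) ∩ W_0^{s,q}(Ω)` if `μ > 0`, and `W_0^{1,p}(Ω)` if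
`μ = 0`. -/
def MemEnergy {d : ℕ} (Ω : Set (EuclideanSpace ℝ (Fin d))) (p q s μ : ℝ)
    (u : EuclideanSpace ℝ (Fin d) → ℝ) : Prop :=
  MemW10 Ω p u ∧ (0 < μ → MemWs0 Ω s q u)

/-- `⟨-Δ_p u, φ⟩`. -/
def pLaplacePairing {d : ℕ} (Ω : Set (EuclideanSpace ℝ (Fin d))) (p : ℝ)
    (u φ : EuclideanSpace ℝ (Fin d) → ℝ) : ℝ :=
  ∫ x in Ω, ‖weakGrad Ω u x‖ ^ (p - 2) * inner ℝ (weakGrad Ω u x) (weakGrad Ω φ x)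

/-- `⟨(-Δ)^s_q u, φ⟩`. -/
def fracPairing {d : ℕ} (s q : ℝ) (u φ : EuclideanSpace ℝ (Fin d) → ℝ) : ℝ :=
  ∫ z : EuclideanSpace ℝ (Fin d) × EuclideanSpace ℝ (Fin d),
    |u z.1 - u z.2| ^ (q - 2) * (u z.1 - u z.2) * (φ z.1 - φ z.2) /
      ‖z.1 - z.2‖ ^ ((d : ℝ) + s * q)

/-- `⟨𝒜_μ u, φ⟩ = ⟨-Δ_p u, φ⟩ + μ ⟨(-Δ)^s_q u, φ⟩`. -/
def mixedPairing {d : ℕ} (Ω : Set (EuclideanSpace ℝ (Fin d))) (p q s μ : ℝ)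
    (u φ : EuclideanSpace ℝ (Fin d) → ℝ) : ℝ :=
  pLaplacePairing Ω p u φ + μ * fracPairing s q u φ

/-- `⟨div f(u), φ⟩ = -∫_Ω f(u) · ∇φ`. -/
def divPairing {d : ℕ} (Ω : Set (EuclideanSpace ℝ (Fin d))) (f : Fin d → ℝ → ℝ)
    (u φ : EuclideanSpace ℝ (Fin d) → ℝ) : ℝ :=
  -∫ x in Ω, ∑ i, f i (u x) * weakPartial Ω i φ x

/-- Conditions on `β`, an increasing bijection of `ℝ`: `β(0) = 0`, local `α`-Hölder continuity,
local strong monotonicity, and growth of order `p - 1`. -/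
structure AdmissibleBeta (β : ℝ ≃o ℝ) (α p : ℝ) : Prop where
  map_zero : β 0 = 0
  locally_holder : ∀ K > 0, ∃ C : ℝ, ∀ t ∈ Set.Icc (-K) K, ∀ t' ∈ Set.Icc (-K) K,
    |β t - β t'| ≤ C * |t - t'| ^ α
  lower_bound : ∀ K > 0, ∃ C > 0, ∀ t t' : ℝ, -K ≤ t' → t' ≤ t → t ≤ K →
    C * (t - t') ≤ β t - β t'
  growth : ∃ c : ℝ, ∀ t : ℝ, |β t| ≤ c * (1 + |t| ^ (p - 1))

/-- `h ∈ W^{1,∞}(ℝ)` (continuous representative: bounded and Lipschitz), with `h(0) = 0`. -/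
structure AdmissibleFlux (h : ℝ → ℝ) : Prop where
  map_zero : h 0 = 0
  bounded : ∃ C : ℝ, ∀ t, |h t| ≤ C
  lipschitz : ∃ K, LipschitzWith K h

/-- `β⁻¹(v)` for `v ∈ L^1(Ω)`, extended by `0` to `ℝ^d`. -/
def betaInv {d : ℕ} (Ω : Set (EuclideanSpace ℝ (Fin d))) (β : ℝ ≃o ℝ)
    (v : Lp ℝ 1 (volume.restrict Ω)) : EuclideanSpace ℝ (Fin d) → ℝ :=
  Ω.indicator (fun x => β.symm (v x))

/-- The graph in `L^1(Ω) × L^1(Ω)` of `A(v) = 𝒜_μ(β⁻¹(v)) - div f(β⁻¹(v))` on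
`D(A) = {v ∈ L^1(Ω) | β⁻¹(v) ∈ 𝒲, A(v) ∈ L^1(Ω)}`. The functional `A(v) ∈ 𝒲*` equals
`w ∈ L^1(Ω)` when `⟨A(v), φ⟩ = ∫_Ω w φ` for all `φ ∈ 𝒲 ∩ L^∞(Ω)`; as `C_c^∞(Ω)` is contained
in this space, `w` is unique. -/
def operatorGraph {d : ℕ} (Ω : Set (EuclideanSpace ℝ (Fin d))) (p q s μ : ℝ)
    (β : ℝ ≃o ℝ) (f : Fin d → ℝ → ℝ) :
    Set (Lp ℝ 1 (volume.restrict Ω) × Lp ℝ 1 (volume.restrict Ω)) :=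
  {z | MemEnergy Ω p q s μ (betaInv Ω β z.1) ∧
    ∀ φ, MemEnergy Ω p q s μ φ → MemLp φ ⊤ (volume.restrict Ω) →
      mixedPairing Ω p q s μ (betaInv Ω β z.1) φ - divPairing Ω f (betaInv Ω β z.1) φ =
        ∫ x in Ω, z.2 x * φ x}

/-- A (graph of a) possibly multivalued operator `A ⊆ X × X` on a real normed space is accretive
if for all `(x₁, y₁), (x₂, y₂) ∈ A` there is `w ∈ J(x₁ - x₂)` with `⟨w, y₁ - y₂⟩ ≥ 0`, where
`J(x) = {w ∈ X* | ⟨w, x⟩ = ‖x‖² = ‖w‖²}` is the duality mapping. -/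
def IsAccretive {X : Type*} [NormedAddCommGroup X] [NormedSpace ℝ X] (A : Set (X × X)) : Prop :=
  ∀ z₁ ∈ A, ∀ z₂ ∈ A, ∃ w : StrongDual ℝ X,
    w (z₁.1 - z₂.1) = ‖z₁.1 - z₂.1‖ ^ 2 ∧ ‖w‖ = ‖z₁.1 - z₂.1‖ ∧ 0 ≤ w (z₁.2 - z₂.2)

end MixedOp

end

/-! The duality mapping of L¹ at z contains ‖z‖ sgn z, so accretivity follows from ∫ (A v₁ − A v₂)
sgn(v₁ − v₂) ≥ 0. Since β⁻¹ is strictly increasing, this sign equals sgn w with w = u₁ − u₂ and u_j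
= β⁻¹(v_j). The sign is replaced by arctan(k w), which lies in 𝒲 ∩ L^∞ and tends to (π/2) sgn w. For
every k the principal part contributes a nonnegative amount, because arctan(k ·) is increasing and a
↦ |a|^{r−2} a is monotone (`mixedPairing_arctan_sub_nonneg`). The i-th flux integrand is at most K
|∂_i w| · k|w|/(1 + k²w²), and the last factor is bounded by 1 and tends to 0, so the flux
disappears in the limit (`tendsto_integral_flux_mul_weakPartial_arctan`).

The sign identity is the same limit after an integration by parts, once f(u) ∈ W^{1,p}(Ω) is known.
No chain rule for Lipschitz f is used for this: `MemW10.memW1_comp_lipschitz` argues by duality. The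
functional ψ ↦ ∫ f(u) ∂_i ψ is dominated by ∫ K |∂_i u| |ψ|, so it is represented by some g ∈ L²
(`exists_memLp_two_of_test_bound`); mollification then gives |g| ≤ K |∂_i u| a.e.
(`ae_abs_le_of_test_bound`), hence g ∈ L^p. -/

namespace MixedOp

/-! ### Limits of integrals from convergence in L^p. -/

section LpTools

variable {X : Type*} [MeasurableSpace X] {ν : Measure X}

theorem integrable_mul_of_memLp_two {f g : X → ℝ} (hf : MemLp f 2 ν) (hg : MemLp g 2 ν) :
    Integrable (fun x => f x * g x) ν :=
  hf.integrable_mul hg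

theorem abs_integral_mul_le_eLpNorm_two {f g : X → ℝ} (hf : MemLp f 2 ν) (hg : MemLp g 2 ν) :
    |∫ x, f x * g x ∂ν| ≤ (eLpNorm f 2 ν * eLpNorm g 2 ν).toReal := by
  have h1 : eLpNorm (fun x => f x * g x) 1 ν ≤ eLpNorm f 2 ν * eLpNorm g 2 ν :=
    eLpNorm_smul_le_mul_eLpNorm (φ := f) (f := g) hg.1 hf.1
  have h2 : |∫ x, f x * g x ∂ν| ≤ (eLpNorm (fun x => f x * g x) 1 ν).toReal := by
    rw [eLpNorm_one_eq_lintegral_enorm, 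
      ← integral_norm_eq_lintegral_enorm (f := fun x => f x * g x) (hf.1.mul hg.1)]
    exact abs_integral_le_integral_abs
  exact h2.trans (ENNReal.toReal_mono (ENNReal.mul_ne_top hf.2.ne hg.2.ne) h1)

theorem tendsto_eLpNorm_two_of_le [IsFiniteMeasure ν] {P : ENNReal} (hP : 2 ≤ P)
    {F : ℕ → X → ℝ} (hF : ∀ n, AEStronglyMeasurable (F n) ν)
    (ht : Tendsto (fun n => eLpNorm (F n) P ν) atTop (𝓝 0)) :
    Tendsto (fun n => eLpNorm (F n) 2 ν) atTop (𝓝 0) := by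
  set C := ν Set.univ ^ (1 / (2 : ENNReal).toReal - 1 / P.toReal) with hC
  have hCtop : C ≠ ⊤ := by
    refine ENNReal.rpow_ne_top_of_nonneg ?_ (measure_ne_top _ _)
    -- For `P = ⊤` the convention `⊤.toReal = 0` makes the exponent 1/2.
    by_cases hPt : P = ⊤
    · simp [hPt]
    · have : (2 : ENNReal).toReal ≤ P.toReal := ENNReal.toReal_mono hPt hP
      have h2 : (0 : ℝ) < (2 : ENNReal).toReal := by simp
      exact sub_nonneg.2 (one_div_le_one_div_of_le h2 this)
  have h0 : Tendsto (fun n => eLpNorm (F n) P ν * C) atTop (𝓝 (0 * C)) :=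
    ENNReal.Tendsto.mul_const ht (Or.inr hCtop)
  rw [zero_mul] at h0
  exact tendsto_of_tendsto_of_tendsto_of_le_of_le tendsto_const_nhds h0 (fun _ => zero_le)
    (fun n => eLpNorm_le_eLpNorm_mul_rpow_measure_univ hP (hF n))

/-- On a finite measure space L^P convergence with P ≥ 2 implies L² convergence, and Cauchy–Schwarz
does the rest. Integration by parts passes to limits of test functions through this lemma, with L²
in place of the conjugate exponent. -/
theorem tendsto_integral_mul_of_tendsto_eLpNorm [IsFiniteMeasure ν] {P : ENNReal} (hP : 2 ≤ P)
    {F : ℕ → X → ℝ} {G h : X → ℝ} (hF : ∀ n, MemLp (F n) P ν) (hG : MemLp G P ν)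
    (hh : MemLp h 2 ν)
    (ht : Tendsto (fun n => eLpNorm (fun x => G x - F n x) P ν) atTop (𝓝 0)) :
    Tendsto (fun n => ∫ x, F n x * h x ∂ν) atTop (𝓝 (∫ x, G x * h x ∂ν)) := by
  have ht2 := tendsto_eLpNorm_two_of_le hP (fun n => hG.1.sub (hF n).1) ht
  have hb : Tendsto (fun n => (eLpNorm (fun x => G x - F n x) 2 ν * eLpNorm h 2 ν).toReal)
      atTop (𝓝 0) := by
    have := ENNReal.Tendsto.mul_const (b := eLpNorm h 2 ν) ht2 (Or.inr hh.2.ne)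
    rw [zero_mul] at this
    exact (ENNReal.tendsto_toReal ENNReal.zero_ne_top).comp this
  rw [tendsto_iff_norm_sub_tendsto_zero]
  refine squeeze_zero (fun _ => norm_nonneg _) (fun n => ?_) hb
  have hF2 := (hF n).mono_exponent hP
  have hG2 := hG.mono_exponent hP
  rw [norm_sub_rev, ← integral_sub (integrable_mul_of_memLp_two hG2 hh)
    (integrable_mul_of_memLp_two hF2 hh)]
  refine le_trans (le_of_eq ?_) (abs_integral_mul_le_eLpNorm_two (hG2.sub hF2) hh)
  simp [sub_mul]

/-- Dominated convergence in `L^P`, in the form of convergence to `0`. -/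
theorem tendsto_eLpNorm_zero_of_dominated {P : ENNReal} (hP0 : P ≠ 0) (hPt : P ≠ ⊤)
    {F : ℕ → X → ℝ} {g : X → ℝ} (hF : ∀ n, AEStronglyMeasurable (F n) ν) (hg : MemLp g P ν)
    (hb : ∀ n, ∀ᵐ x ∂ν, ‖F n x‖ ≤ ‖g x‖)
    (ht : ∀ᵐ x ∂ν, Tendsto (fun n => F n x) atTop (𝓝 0)) :
    Tendsto (fun n => eLpNorm (F n) P ν) atTop (𝓝 0) := by
  have hpos : 0 < P.toReal := ENNReal.toReal_pos hP0 hPt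
  simp_rw [eLpNorm_eq_lintegral_rpow_enorm_toReal hP0 hPt]
  have h1 : Tendsto (fun n => ∫⁻ x, ‖F n x‖ₑ ^ P.toReal ∂ν) atTop (𝓝 (∫⁻ _, 0 ∂ν)) := by
    refine tendsto_lintegral_of_dominated_convergence' (fun x => ‖g x‖ₑ ^ P.toReal)
      (fun n => (hF n).enorm.pow_const _) (fun n => ?_) ?_ ?_
    · filter_upwards [hb n] with x hx
      exact ENNReal.rpow_le_rpow (enorm_le_iff_norm_le.2 hx) hpos.le
    · exact (lintegral_rpow_enorm_lt_top_of_eLpNorm_lt_top hP0 hPt hg.2).ne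
    · filter_upwards [ht] with x hx
      have : Tendsto (fun n => ‖F n x‖ₑ ^ P.toReal) atTop (𝓝 (‖(0 : ℝ)‖ₑ ^ P.toReal)) :=
        (ENNReal.continuous_rpow_const.tendsto _).comp (hx.enorm)
      simpa [ENNReal.zero_rpow_of_pos hpos] using this
  have h2 := (ENNReal.continuous_rpow_const (y := 1 / P.toReal)).tendsto _ |>.comp h1
  simpa [Function.comp_def, ENNReal.zero_rpow_of_pos (inv_pos.2 hpos)] using h2

end LpTools

/-! ### Calculus of test functions. -/

section TestFunctions

variable {d : ℕ} {Ω : Set (EuclideanSpace ℝ (Fin d))} {φ ψ : EuclideanSpace ℝ (Fin d) → ℝ}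

theorem IsTestFunction.differentiable (hφ : IsTestFunction Ω φ) : Differentiable ℝ φ :=
  hφ.contDiff.differentiable (by simp)

theorem IsTestFunction.continuous_partialDeriv (hφ : IsTestFunction Ω φ) (i : Fin d) :
    Continuous (partialDeriv i φ) :=
  (hφ.contDiff.continuous_fderiv (by simp)).clm_apply continuous_const

theorem IsTestFunction.hasCompactSupport_partialDeriv (hφ : IsTestFunction Ω φ) (i : Fin d) :
    HasCompactSupport (partialDeriv i φ) :=
  hφ.hasCompactSupport.fderiv_apply ℝ _

theorem IsTestFunction.memLp (hφ : IsTestFunction Ω φ) (P : ENNReal) :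
    MemLp φ P (volume.restrict Ω) :=
  (hφ.contDiff.continuous.memLp_of_hasCompactSupport hφ.hasCompactSupport).restrict Ω

theorem IsTestFunction.memLp_partialDeriv (hφ : IsTestFunction Ω φ) (i : Fin d) (P : ENNReal) :
    MemLp (partialDeriv i φ) P (volume.restrict Ω) :=
  ((hφ.continuous_partialDeriv i).memLp_of_hasCompactSupport
    (hφ.hasCompactSupport_partialDeriv i)).restrict Ω

theorem IsTestFunction.exists_lipschitz (hφ : IsTestFunction Ω φ) : ∃ C, LipschitzWith C φ :=
  ContDiff.lipschitzWith_of_hasCompactSupport hφ.hasCompactSupport hφ.contDiff (by simp)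

theorem IsTestFunction.add (hφ : IsTestFunction Ω φ) (hψ : IsTestFunction Ω ψ) :
    IsTestFunction Ω (fun x => φ x + ψ x) where
  contDiff := hφ.contDiff.add hψ.contDiff
  hasCompactSupport := hφ.hasCompactSupport.add hψ.hasCompactSupport
  tsupport_subset := (tsupport_add φ ψ).trans
    (Set.union_subset hφ.tsupport_subset hψ.tsupport_subset)

theorem IsTestFunction.comp (hφ : IsTestFunction Ω φ) {T : ℝ → ℝ} (hT : ContDiff ℝ (⊤ : ℕ∞) T)
    (h0 : T 0 = 0) : IsTestFunction Ω (fun x => T (φ x)) where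
  contDiff := hT.comp hφ.contDiff
  hasCompactSupport := hφ.hasCompactSupport.comp_left h0
  tsupport_subset := (tsupport_comp_subset h0 φ).trans hφ.tsupport_subset

theorem IsTestFunction.const_mul (hφ : IsTestFunction Ω φ) (c : ℝ) :
    IsTestFunction Ω (fun x => c * φ x) :=
  hφ.comp (T := fun t => c * t) (by fun_prop) (by simp)

theorem IsTestFunction.sub (hφ : IsTestFunction Ω φ) (hψ : IsTestFunction Ω ψ) :
    IsTestFunction Ω (fun x => φ x - ψ x) := by
  simpa [sub_eq_add_neg] using hφ.add (hψ.const_mul (-1))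

theorem IsTestFunction.zero : IsTestFunction Ω (fun _ => 0) where
  contDiff := contDiff_const
  hasCompactSupport := HasCompactSupport.zero
  tsupport_subset := by simp [tsupport]

theorem IsTestFunction.partialDeriv_add (hφ : IsTestFunction Ω φ) (hψ : IsTestFunction Ω ψ)
    (i : Fin d) (x : EuclideanSpace ℝ (Fin d)) :
    partialDeriv i (fun x => φ x + ψ x) x = partialDeriv i φ x + partialDeriv i ψ x := by
  have := fderiv_fun_add (hφ.differentiable x) (hψ.differentiable x)
  simp [partialDeriv, this]

theorem IsTestFunction.partialDeriv_sub (hφ : IsTestFunction Ω φ) (hψ : IsTestFunction Ω ψ)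
    (i : Fin d) (x : EuclideanSpace ℝ (Fin d)) :
    partialDeriv i (fun x => φ x - ψ x) x = partialDeriv i φ x - partialDeriv i ψ x := by
  have := fderiv_fun_sub (hφ.differentiable x) (hψ.differentiable x)
  simp [partialDeriv, this]

theorem IsTestFunction.partialDeriv_comp (hφ : IsTestFunction Ω φ) {T : ℝ → ℝ}
    (hT : Differentiable ℝ T) (i : Fin d) (x : EuclideanSpace ℝ (Fin d)) :
    partialDeriv i (fun x => T (φ x)) x = deriv T (φ x) * partialDeriv i φ x := by
  have h := ((hT (φ x)).hasDerivAt.comp_hasFDerivAt x (hφ.differentiable x).hasFDerivAt).fderiv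
  simp only [Function.comp_def] at h
  simp [partialDeriv, h]

theorem IsTestFunction.partialDeriv_const_mul (hφ : IsTestFunction Ω φ) (c : ℝ)
    (i : Fin d) (x : EuclideanSpace ℝ (Fin d)) :
    partialDeriv i (fun x => c * φ x) x = c * partialDeriv i φ x := by
  have := hφ.partialDeriv_comp (T := fun t => c * t) (by fun_prop) i x
  simpa using this

theorem IsTestFunction.lineDeriv_eq (hφ : IsTestFunction Ω φ) (i : Fin d)
    (x : EuclideanSpace ℝ (Fin d)) :
    lineDeriv ℝ φ x (EuclideanSpace.single i 1) = partialDeriv i φ x :=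
  (hφ.differentiable x).lineDeriv_eq_fderiv

theorem IsTestFunction.setIntegral_mul_eq (hφ : IsTestFunction Ω φ)
    (g : EuclideanSpace ℝ (Fin d) → ℝ) : ∫ x in Ω, g x * φ x = ∫ x, g x * φ x := by
  refine setIntegral_eq_integral_of_forall_compl_eq_zero fun x hx => ?_
  have : φ x = 0 := by
    by_contra h
    exact hx (hφ.tsupport_subset (subset_tsupport _ h))
  simp [this]

theorem IsTestFunction.setIntegral_mul_partialDeriv_eq (hφ : IsTestFunction Ω φ) (i : Fin d)
    (g : EuclideanSpace ℝ (Fin d) → ℝ) :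
    ∫ x in Ω, g x * partialDeriv i φ x = ∫ x, g x * partialDeriv i φ x := by
  refine setIntegral_eq_integral_of_forall_compl_eq_zero fun x hx => ?_
  have : fderiv ℝ φ x = 0 := by
    by_contra h
    exact hx (hφ.tsupport_subset (support_fderiv_subset ℝ h))
  simp [partialDeriv, this]

/-- Integration by parts of a Lipschitz function against a test function. -/
theorem IsTestFunction.setIntegral_lipschitz_mul_partialDeriv (hφ : IsTestFunction Ω φ)
    (i : Fin d) {g : EuclideanSpace ℝ (Fin d) → ℝ} {C : NNReal} (hg : LipschitzWith C g) :
    ∫ x in Ω, g x * partialDeriv i φ x =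
      -∫ x in Ω, lineDeriv ℝ g x (EuclideanSpace.single i 1) * φ x := by
  obtain ⟨D, hD⟩ := hφ.exists_lipschitz
  rw [hφ.setIntegral_mul_partialDeriv_eq, hφ.setIntegral_mul_eq,
    hg.integral_lineDeriv_mul_eq hD hφ.hasCompactSupport, ← integral_neg]
  refine integral_congr_ae (Eventually.of_forall fun x => ?_)
  -- The Lipschitz integration by parts formula differentiates φ in the direction −e_i; this
  -- produces the minus sign.
  simp [lineDeriv_neg, hφ.lineDeriv_eq, mul_comm]

theorem IsTestFunction.setIntegral_mul_partialDeriv (hφ : IsTestFunction Ω φ)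
    (hψ : IsTestFunction Ω ψ) (i : Fin d) :
    ∫ x in Ω, ψ x * partialDeriv i φ x = -∫ x in Ω, partialDeriv i ψ x * φ x := by
  obtain ⟨C, hC⟩ := hψ.exists_lipschitz
  simpa [hψ.lineDeriv_eq] using hφ.setIntegral_lipschitz_mul_partialDeriv i hC

end TestFunctions

/-! ### Uniqueness and linearity of weak derivatives. -/

section WeakDerivatives

variable {d : ℕ} {Ω : Set (EuclideanSpace ℝ (Fin d))} {i : Fin d}
  {u v g h : EuclideanSpace ℝ (Fin d) → ℝ}

theorem setIntegrable_mul_of_hasCompactSupport {φ : EuclideanSpace ℝ (Fin d) → ℝ}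
    (hg : LocallyIntegrableOn g Ω) (hφ : Continuous φ)
    (hc : HasCompactSupport φ) (hs : tsupport φ ⊆ Ω) :
    Integrable (fun x => g x * φ x) (volume.restrict Ω) := by
  have h1 : IntegrableOn (fun x => g x * φ x) (tsupport φ) :=
    (hg.integrableOn_compact_subset hs hc).mul_continuousOn hφ.continuousOn hc
  refine Integrable.restrict ((integrableOn_iff_integrable_of_support_subset ?_).1 h1)
  intro x hx
  exact subset_tsupport _ (right_ne_zero_of_mul hx)

theorem IsTestFunction.tsupport_partialDeriv_subset {φ : EuclideanSpace ℝ (Fin d) → ℝ}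
    (hφ : IsTestFunction Ω φ) (i : Fin d) : tsupport (partialDeriv i φ) ⊆ Ω :=
  (tsupport_fderiv_apply_subset ℝ _).trans hφ.tsupport_subset

/-- This is the fundamental lemma of the calculus of variations applied to g − h. It identifies the
arbitrarily chosen `weakPartial` with any weak derivative at hand. -/
theorem HasWeakPartial.ae_unique (hΩ : IsOpen Ω) (hg : HasWeakPartial Ω i u g)
    (hh : HasWeakPartial Ω i u h) : g =ᵐ[volume.restrict Ω] h := by
  have key := hΩ.ae_eq_zero_of_integral_contDiff_smul_eq_zero
    (hg.locallyIntegrableOn_deriv.sub hh.locallyIntegrableOn_deriv) (fun φ h1 h2 h3 => by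
      have hφ : IsTestFunction Ω φ := ⟨h1, h2, h3⟩
      have e := neg_injective ((hg.integral_eq φ hφ).symm.trans (hh.integral_eq φ hφ))
      have e2 : ∫ x in Ω, (g x - h x) * φ x = 0 := by
        simp_rw [sub_mul]
        rw [integral_sub, e, sub_self]
        · exact setIntegrable_mul_of_hasCompactSupport hg.locallyIntegrableOn_deriv
            h1.continuous h2 h3
        · exact setIntegrable_mul_of_hasCompactSupport hh.locallyIntegrableOn_deriv
            h1.continuous h2 h3
      rw [hφ.setIntegral_mul_eq] at e2
      simpa [mul_comm] using e2)
  rw [EventuallyEq, ae_restrict_iff' hΩ.measurableSet]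
  filter_upwards [key] with x hx hxΩ
  exact sub_eq_zero.1 (hx hxΩ)

theorem HasWeakPartial.hasWeakPartial_weakPartial (hg : HasWeakPartial Ω i u g) :
    HasWeakPartial Ω i u (weakPartial Ω i u) := by
  have h : ∃ g, HasWeakPartial Ω i u g := ⟨g, hg⟩
  rw [weakPartial, dif_pos h]
  exact h.choose_spec

theorem HasWeakPartial.weakPartial_ae_eq (hΩ : IsOpen Ω) (hg : HasWeakPartial Ω i u g) :
    weakPartial Ω i u =ᵐ[volume.restrict Ω] g :=
  hg.hasWeakPartial_weakPartial.ae_unique hΩ hg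

theorem HasWeakPartial.sub (hg : HasWeakPartial Ω i u g)
    (hh : HasWeakPartial Ω i v h) :
    HasWeakPartial Ω i (fun x => u x - v x) (fun x => g x - h x) where
  locallyIntegrableOn := hg.locallyIntegrableOn.sub hh.locallyIntegrableOn
  locallyIntegrableOn_deriv := hg.locallyIntegrableOn_deriv.sub hh.locallyIntegrableOn_deriv
  integral_eq φ hφ := by
    have I1 {w : EuclideanSpace ℝ (Fin d) → ℝ} (hw : LocallyIntegrableOn w Ω) :
        Integrable (fun x => w x * φ x) (volume.restrict Ω) :=
      setIntegrable_mul_of_hasCompactSupport hw hφ.contDiff.continuous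
        hφ.hasCompactSupport hφ.tsupport_subset
    have I2 {w : EuclideanSpace ℝ (Fin d) → ℝ} (hw : LocallyIntegrableOn w Ω) :
        Integrable (fun x => w x * partialDeriv i φ x) (volume.restrict Ω) :=
      setIntegrable_mul_of_hasCompactSupport hw (hφ.continuous_partialDeriv i)
        (hφ.hasCompactSupport_partialDeriv i) (hφ.tsupport_partialDeriv_subset i)
    simp_rw [sub_mul]
    rw [integral_sub (I2 hg.locallyIntegrableOn) (I2 hh.locallyIntegrableOn),
      integral_sub (I1 hg.locallyIntegrableOn_deriv) (I1 hh.locallyIntegrableOn_deriv),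
      hg.integral_eq φ hφ, hh.integral_eq φ hφ]
    ring

end WeakDerivatives

/-! ### The spaces W^{1,p} and W_0^{1,p}: differences, integration by parts, smooth chain rule. -/

section SobolevSpaces

variable {d : ℕ} {Ω : Set (EuclideanSpace ℝ (Fin d))} {i : Fin d} {p : ℝ}
  {u v : EuclideanSpace ℝ (Fin d) → ℝ}

theorem MemW1.hasWeakPartial (hu : MemW1 Ω p u) (i : Fin d) :
    HasWeakPartial Ω i u (weakPartial Ω i u) :=
  let ⟨_, hg, _⟩ := hu.memLp_deriv i
  hg.hasWeakPartial_weakPartial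

theorem MemW1.memLp_weakPartial (hΩ : IsOpen Ω) (hu : MemW1 Ω p u) (i : Fin d) :
    MemLp (weakPartial Ω i u) (ENNReal.ofReal p) (volume.restrict Ω) :=
  let ⟨_, hg, hgp⟩ := hu.memLp_deriv i
  hgp.ae_eq (hg.weakPartial_ae_eq hΩ).symm

theorem MemW1.sub (hu : MemW1 Ω p u) (hv : MemW1 Ω p v) :
    MemW1 Ω p (fun x => u x - v x) where
  memLp := hu.memLp.sub hv.memLp
  memLp_deriv i :=
    let ⟨_, hg, hgp⟩ := hu.memLp_deriv i
    let ⟨_, hh, hhp⟩ := hv.memLp_deriv i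
    ⟨_, hg.sub hh, hgp.sub hhp⟩

theorem MemW1.weakPartial_sub_ae_eq (hΩ : IsOpen Ω) (hu : MemW1 Ω p u) (hv : MemW1 Ω p v)
    (i : Fin d) : weakPartial Ω i (fun x => u x - v x) =ᵐ[volume.restrict Ω]
      fun x => weakPartial Ω i u x - weakPartial Ω i v x :=
  ((hu.hasWeakPartial i).sub (hv.hasWeakPartial i)).weakPartial_ae_eq hΩ

theorem two_le_ofReal (hp : 2 < p) : (2 : ENNReal) ≤ ENNReal.ofReal p := by
  rw [← ENNReal.ofReal_ofNat]
  exact ENNReal.ofReal_le_ofReal hp.le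

theorem tendsto_eLpNorm_sub_of_tendsto {X : Type*} [MeasurableSpace X] {ν : Measure X}
    {P : ENNReal} (hP : 1 ≤ P) {f g : X → ℝ} {F G : ℕ → X → ℝ}
    (hf : ∀ n, MemLp (fun x => f x - F n x) P ν)
    (hg : ∀ n, MemLp (fun x => g x - G n x) P ν)
    (h1 : Tendsto (fun n => eLpNorm (fun x => f x - F n x) P ν) atTop (𝓝 0))
    (h2 : Tendsto (fun n => eLpNorm (fun x => g x - G n x) P ν) atTop (𝓝 0)) :
    Tendsto (fun n => eLpNorm (fun x => (f x - g x) - (F n x - G n x)) P ν) atTop (𝓝 0) := by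
  have h3 := h1.add h2
  rw [add_zero] at h3
  refine tendsto_of_tendsto_of_tendsto_of_le_of_le tendsto_const_nhds h3 (fun _ => zero_le)
    (fun n => ?_)
  have e : (fun x => (f x - g x) - (F n x - G n x)) =
      (fun x => f x - F n x) - fun x => g x - G n x := by
    funext x
    simp only [Pi.sub_apply]
    ring
  simp only [e]
  exact eLpNorm_sub_le (hf n).1 (hg n).1 hP

theorem MemW10.sub (hΩ : IsOpen Ω) (hp : 2 < p) (hu : MemW10 Ω p u) (hv : MemW10 Ω p v) :
    MemW10 Ω p (fun x => u x - v x) where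
  memW1 := hu.memW1.sub hv.memW1
  exists_approx := by
    have hP : 1 ≤ ENNReal.ofReal p := le_trans (by norm_num) (two_le_ofReal hp)
    obtain ⟨φ, hφ, hφ0, hφ1⟩ := hu.exists_approx
    obtain ⟨ψ, hψ, hψ0, hψ1⟩ := hv.exists_approx
    refine ⟨fun n x => φ n x - ψ n x, fun n => (hφ n).sub (hψ n), ?_, fun i => ?_⟩
    · exact tendsto_eLpNorm_sub_of_tendsto hP (fun n => hu.memW1.memLp.sub ((hφ n).memLp _))
        (fun n => hv.memW1.memLp.sub ((hψ n).memLp _)) hφ0 hψ0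
    · refine (tendsto_eLpNorm_sub_of_tendsto hP
        (fun n => (hu.memW1.memLp_weakPartial hΩ i).sub ((hφ n).memLp_partialDeriv i _))
        (fun n => (hv.memW1.memLp_weakPartial hΩ i).sub ((hψ n).memLp_partialDeriv i _))
        (hφ1 i) (hψ1 i)).congr fun n => eLpNorm_congr_ae ?_
      filter_upwards [hu.memW1.weakPartial_sub_ae_eq hΩ hv.memW1 i] with x hx
      rw [hx, (hφ n).partialDeriv_sub (hψ n)]

theorem locallyIntegrableOn_of_memLp [IsFiniteMeasure (volume.restrict Ω)]
    {P : ENNReal} (hP : 1 ≤ P) (hu : MemLp u P (volume.restrict Ω)) :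
    LocallyIntegrableOn u Ω :=
  IntegrableOn.locallyIntegrableOn (hu.integrable hP)

theorem hasWeakPartial_of_tendsto [IsFiniteMeasure (volume.restrict Ω)] {P : ENNReal}
    (hP : 2 ≤ P) {F : ℕ → EuclideanSpace ℝ (Fin d) → ℝ} {g : EuclideanSpace ℝ (Fin d) → ℝ}
    (hF : ∀ n, IsTestFunction Ω (F n)) (hu : MemLp u P (volume.restrict Ω))
    (hg : MemLp g P (volume.restrict Ω))
    (h0 : Tendsto (fun n => eLpNorm (fun x => u x - F n x) P (volume.restrict Ω)) atTop (𝓝 0))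
    (h1 : Tendsto (fun n => eLpNorm (fun x => g x - partialDeriv i (F n) x) P
      (volume.restrict Ω)) atTop (𝓝 0)) : HasWeakPartial Ω i u g where
  locallyIntegrableOn := locallyIntegrableOn_of_memLp (le_trans (by norm_num) hP) hu
  locallyIntegrableOn_deriv := locallyIntegrableOn_of_memLp (le_trans (by norm_num) hP) hg
  integral_eq φ hφ := by
    have l0 := tendsto_integral_mul_of_tendsto_eLpNorm hP (fun n => (hF n).memLp P) hu
      (hφ.memLp_partialDeriv i 2) h0
    have l1 := tendsto_integral_mul_of_tendsto_eLpNorm hP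
      (fun n => (hF n).memLp_partialDeriv i P) hg (hφ.memLp 2) h1
    exact tendsto_nhds_unique l0 (l1.neg.congr fun n =>
      (hφ.setIntegral_mul_partialDeriv (hF n) i).symm)

/-- Integration by parts between `W^{1,p}(Ω)` and `W_0^{1,p}(Ω)`. -/
theorem MemW10.integral_mul_weakPartial [IsFiniteMeasure (volume.restrict Ω)] (hΩ : IsOpen Ω)
    (hp : 2 < p) (hu : MemW10 Ω p u) (hv : MemW1 Ω p v) (i : Fin d) :
    ∫ x in Ω, v x * weakPartial Ω i u x = -∫ x in Ω, weakPartial Ω i v x * u x := by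
  have hP := two_le_ofReal hp
  obtain ⟨φ, hφ, hφ0, hφ1⟩ := hu.exists_approx
  have l0 := tendsto_integral_mul_of_tendsto_eLpNorm hP (fun n => (hφ n).memLp _) hu.memW1.memLp
    ((hv.memLp_weakPartial hΩ i).mono_exponent hP) hφ0
  have l1 := tendsto_integral_mul_of_tendsto_eLpNorm hP
    (fun n => (hφ n).memLp_partialDeriv i _) (hu.memW1.memLp_weakPartial hΩ i)
    (hv.memLp.mono_exponent hP) (hφ1 i)
  simp only [mul_comm (v _), mul_comm (weakPartial Ω i v _)]
  refine tendsto_nhds_unique l1 (l0.neg.congr fun n => ?_)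
  have := (hv.hasWeakPartial i).integral_eq _ (hφ n)
  simp only [mul_comm (v _), mul_comm (weakPartial Ω i v _)] at this
  exact this.symm

/-- L^p convergence implies convergence in measure, hence a.e. along a subsequence. The chain rule
needs this because continuity of T' transports only pointwise convergence. -/
theorem MemW10.exists_approx_ae (hp : 2 < p) (hu : MemW10 Ω p u) :
    ∃ φ : ℕ → EuclideanSpace ℝ (Fin d) → ℝ,
    (∀ n, IsTestFunction Ω (φ n)) ∧
    Tendsto (fun n => eLpNorm (fun x => u x - φ n x) (ENNReal.ofReal p) (volume.restrict Ω))
      atTop (𝓝 0) ∧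
    (∀ i, Tendsto (fun n => eLpNorm (fun x => weakPartial Ω i u x - partialDeriv i (φ n) x)
      (ENNReal.ofReal p) (volume.restrict Ω)) atTop (𝓝 0)) ∧
    ∀ᵐ x ∂(volume.restrict Ω), Tendsto (fun n => φ n x) atTop (𝓝 (u x)) := by
  obtain ⟨φ, hφ, hφ0, hφ1⟩ := hu.exists_approx
  have hm := tendstoInMeasure_of_tendsto_eLpNorm (p := ENNReal.ofReal p) (f := φ) (g := u)
    (by simp; linarith) (fun n => ((hφ n).memLp 1).1) hu.memW1.memLp.1
    (hφ0.congr fun n => eLpNorm_sub_comm _ _ _ _)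
  obtain ⟨ns, hns, hae⟩ := hm.exists_seq_tendsto_ae
  exact ⟨fun n => φ (ns n), fun n => hφ _, hφ0.comp hns.tendsto_atTop,
    fun i => (hφ1 i).comp hns.tendsto_atTop, hae⟩

theorem tendsto_eLpNorm_zero_of_le_mul {X : Type*} [MeasurableSpace X] {ν : Measure X}
    {P : ENNReal} {F G : ℕ → X → ℝ} {C : ℝ} (h : ∀ n, ∀ᵐ x ∂ν, ‖F n x‖ ≤ C * ‖G n x‖)
    (ht : Tendsto (fun n => eLpNorm (G n) P ν) atTop (𝓝 0)) :
    Tendsto (fun n => eLpNorm (F n) P ν) atTop (𝓝 0) := by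
  have h0 := ENNReal.Tendsto.const_mul (a := ENNReal.ofReal C) ht (Or.inr ENNReal.ofReal_ne_top)
  rw [mul_zero] at h0
  exact tendsto_of_tendsto_of_tendsto_of_le_of_le tendsto_const_nhds h0 (fun _ => zero_le)
    (fun n => eLpNorm_le_mul_eLpNorm_of_ae_le_mul (h n) P)

/-- Chain rule in `W_0^{1,p}(Ω)` for smooth functions with bounded derivative. -/
theorem MemW10.comp [IsFiniteMeasure (volume.restrict Ω)] (hΩ : IsOpen Ω) (hp : 2 < p)
    (hu : MemW10 Ω p u) {T : ℝ → ℝ} (hT : ContDiff ℝ (⊤ : ℕ∞) T) (h0 : T 0 = 0) {C : NNReal}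
    (hC : ∀ t, ‖deriv T t‖ ≤ C) :
    MemW10 Ω p (fun x => T (u x)) ∧ ∀ i, weakPartial Ω i (fun x => T (u x)) =ᵐ[volume.restrict Ω]
      fun x => deriv T (u x) * weakPartial Ω i u x := by
  have hP := two_le_ofReal hp
  have hP1 : 1 ≤ ENNReal.ofReal p := le_trans (by norm_num) hP
  have hTd : Differentiable ℝ T := hT.differentiable (by simp)
  have hT' : Continuous (deriv T) := hT.continuous_deriv (by simp)
  have hL : LipschitzWith C T := lipschitzWith_of_nnnorm_deriv_le hTd hC
  obtain ⟨φ, hφ, hφ0, hφ1, hae⟩ := hu.exists_approx_ae hp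
  have hum := hu.memW1.memLp
  have hu1 := fun i => hu.memW1.memLp_weakPartial hΩ i
  have mT : MemLp (fun x => T (u x)) (ENNReal.ofReal p) (volume.restrict Ω) := by
    refine hum.of_le_mul (c := C) (hT.continuous.comp_aestronglyMeasurable hum.1)
      (Eventually.of_forall fun x => ?_)
    have := hL.dist_le_mul (u x) 0
    simpa [h0] using this
  have mT' : ∀ i, MemLp (fun x => deriv T (u x) * weakPartial Ω i u x) (ENNReal.ofReal p)
      (volume.restrict Ω) := fun i => by
    refine (hu1 i).of_le_mul (c := C) ((hT'.comp_aestronglyMeasurable hum.1).mul (hu1 i).1)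
      (Eventually.of_forall fun x => ?_)
    rw [norm_mul]
    exact mul_le_mul_of_nonneg_right (hC _) (norm_nonneg _)
  have c0 : Tendsto (fun n => eLpNorm (fun x => T (u x) - T (φ n x)) (ENNReal.ofReal p)
      (volume.restrict Ω)) atTop (𝓝 0) := by
    refine tendsto_eLpNorm_zero_of_le_mul (C := C) (fun n => Eventually.of_forall fun x => ?_) hφ0
    exact hL.dist_le_mul (u x) (φ n x)
  have c1 : ∀ i, Tendsto (fun n => eLpNorm (fun x => deriv T (u x) * weakPartial Ω i u x -
      partialDeriv i (fun x => T (φ n x)) x) (ENNReal.ofReal p) (volume.restrict Ω))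
      atTop (𝓝 0) := fun i => by
    -- T'(u)∂u − T'(φ_n)∂φ_n splits as (T'(u) − T'(φ_n))∂u + T'(φ_n)(∂u − ∂φ_n). The first term
    -- tends to 0 by dominated convergence with majorant 2C|∂u|, the second because T' is bounded.
    have a1 : Tendsto (fun n => eLpNorm (fun x => (deriv T (u x) - deriv T (φ n x)) *
        weakPartial Ω i u x) (ENNReal.ofReal p) (volume.restrict Ω)) atTop (𝓝 0) := by
      refine tendsto_eLpNorm_zero_of_dominated (by simp; linarith) ENNReal.ofReal_ne_top
        (fun n => ((hT'.comp_aestronglyMeasurable hum.1).sub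
          (hT'.comp_aestronglyMeasurable ((hφ n).memLp 1).1)).mul (hu1 i).1)
        ((hu1 i).const_mul (C + C : ℝ)) (fun n => Eventually.of_forall fun x => ?_) ?_
      · rw [norm_mul, norm_mul]
        refine mul_le_mul_of_nonneg_right ?_ (norm_nonneg _)
        exact ((norm_sub_le _ _).trans (add_le_add (hC _) (hC _))).trans (le_abs_self _)
      · filter_upwards [hae] with x hx
        have := ((hT'.tendsto _).comp hx).const_sub (deriv T (u x)) |>.mul_const
          (weakPartial Ω i u x)
        simpa using this
    have a2 : Tendsto (fun n => eLpNorm (fun x => deriv T (φ n x) *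
        (weakPartial Ω i u x - partialDeriv i (φ n) x)) (ENNReal.ofReal p) (volume.restrict Ω))
        atTop (𝓝 0) := by
      refine tendsto_eLpNorm_zero_of_le_mul (C := C) (fun n => Eventually.of_forall fun x => ?_)
        (hφ1 i)
      rw [norm_mul]
      exact mul_le_mul_of_nonneg_right (hC _) (norm_nonneg _)
    have a3 := a1.add a2
    rw [add_zero] at a3
    refine tendsto_of_tendsto_of_tendsto_of_le_of_le tendsto_const_nhds a3 (fun _ => zero_le)
      (fun n => ?_)
    have e : (fun x => deriv T (u x) * weakPartial Ω i u x -
        partialDeriv i (fun x => T (φ n x)) x) =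
        (fun x => (deriv T (u x) - deriv T (φ n x)) * weakPartial Ω i u x) +
        fun x => deriv T (φ n x) * (weakPartial Ω i u x - partialDeriv i (φ n) x) := by
      funext x
      simp only [Pi.add_apply, (hφ n).partialDeriv_comp hTd]
      ring
    simp only [e]
    have mφ := hT'.comp_aestronglyMeasurable ((hφ n).memLp 1).1
    exact eLpNorm_add_le (((hT'.comp_aestronglyMeasurable hum.1).sub mφ).mul (hu1 i).1)
      (mφ.mul ((hu1 i).1.sub ((hφ n).memLp_partialDeriv i 1).1)) hP1
  have hψ : ∀ n, IsTestFunction Ω (fun x => T (φ n x)) := fun n => (hφ n).comp hT h0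
  have hw : ∀ i, HasWeakPartial Ω i (fun x => T (u x))
      (fun x => deriv T (u x) * weakPartial Ω i u x) := fun i =>
    hasWeakPartial_of_tendsto hP hψ mT (mT' i) c0 (c1 i)
  have hae' := fun i => (hw i).weakPartial_ae_eq hΩ
  refine ⟨⟨⟨mT, fun i => ⟨_, hw i, mT' i⟩⟩, _, hψ, c0, fun i => ?_⟩, hae'⟩
  refine (c1 i).congr fun n => eLpNorm_congr_ae ?_
  filter_upwards [hae' i] with x hx
  rw [hx]

end SobolevSpaces

/-! ### Lipschitz composition in W_0^{1,p} by duality. -/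

/-- A functional dominated by the norm of a linear map into a Hilbert space is represented by a
vector of that space. -/
theorem exists_inner_eq_of_abs_le {V H : Type*} [AddCommGroup V] [Module ℝ V]
    [NormedAddCommGroup H] [InnerProductSpace ℝ H] [CompleteSpace H] (J : V →ₗ[ℝ] H)
    (l : V →ₗ[ℝ] ℝ) (C : ℝ) (h : ∀ v, |l v| ≤ C * ‖J v‖) :
    ∃ g : H, ∀ v, l v = inner ℝ g (J v) := by
  -- A linear section r of J transports l to the range of J as l ∘ r. The choice of r is immaterial:
  -- the bound forces l to vanish on ker J.
  obtain ⟨r, hr⟩ := LinearMap.exists_rightInverse_of_surjective J.rangeRestrict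
    (LinearMap.range_eq_top.2 J.surjective_rangeRestrict)
  have hJ : ∀ y : J.range, J (r y) = y := fun y => by
    have := LinearMap.congr_fun hr y
    exact congrArg Subtype.val this
  have hl : ∀ v, l (r (J.rangeRestrict v)) = l v := fun v => by
    have h1 := h (r (J.rangeRestrict v) - v)
    rw [map_sub, map_sub, hJ] at h1
    simp only [LinearMap.codRestrict_apply, LinearMap.rangeRestrict] at h1 ⊢
    simp only [sub_self, norm_zero, mul_zero] at h1
    exact sub_eq_zero.1 (abs_nonpos_iff.1 h1)
  let m : StrongDual ℝ J.range := (l ∘ₗ r).mkContinuous C fun y => by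
    have := h (r y)
    rwa [hJ] at this
  -- Hahn–Banach extends from the range, which need not be closed, to all of H, where the Riesz
  -- representation applies.
  obtain ⟨M, hM, -⟩ := exists_extension_norm_eq J.range m
  refine ⟨(InnerProductSpace.toDual ℝ H).symm M, fun v => ?_⟩
  rw [InnerProductSpace.toDual_symm_apply]
  have := hM (J.rangeRestrict v)
  rw [← hl v]
  exact this.symm

section

variable {d : ℕ} {Ω : Set (EuclideanSpace ℝ (Fin d))} {i : Fin d} {p : ℝ}
  {u v : EuclideanSpace ℝ (Fin d) → ℝ}

/-- The space `C_c^∞(Ω)`. -/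
def testSpace (Ω : Set (EuclideanSpace ℝ (Fin d))) :
    Submodule ℝ (EuclideanSpace ℝ (Fin d) → ℝ) where
  carrier := {φ | IsTestFunction Ω φ}
  add_mem' h1 h2 := h1.add h2
  zero_mem' := IsTestFunction.zero
  smul_mem' c _ h := h.const_mul c

/-- A locally bounded pairing with test functions is represented by an `L^2` function. -/
theorem exists_memLp_two_of_test_bound
    {F w : EuclideanSpace ℝ (Fin d) → ℝ} (hF : MemLp F 2 (volume.restrict Ω))
    (hw : MemLp w 2 (volume.restrict Ω))
    (hb : ∀ φ, IsTestFunction Ω φ →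
      |∫ x in Ω, F x * partialDeriv i φ x| ≤ ∫ x in Ω, w x * |φ x|) :
    ∃ g, MemLp g 2 (volume.restrict Ω) ∧ ∀ φ, IsTestFunction Ω φ →
      ∫ x in Ω, F x * partialDeriv i φ x = -∫ x in Ω, g x * φ x := by
  let J : testSpace Ω →ₗ[ℝ] Lp ℝ 2 (volume.restrict Ω) :=
    { toFun := fun φ => (φ.2.memLp 2).toLp φ.1
      map_add' := fun φ ψ => MemLp.toLp_add (φ.2.memLp 2) (ψ.2.memLp 2)
      map_smul' := fun c φ => MemLp.toLp_const_smul c (φ.2.memLp 2) }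
  let l : testSpace Ω →ₗ[ℝ] ℝ :=
    { toFun := fun φ => ∫ x in Ω, F x * partialDeriv i φ.1 x
      map_add' := fun φ ψ => by
        rw [← integral_add (integrable_mul_of_memLp_two hF (φ.2.memLp_partialDeriv i 2))
          (integrable_mul_of_memLp_two hF (ψ.2.memLp_partialDeriv i 2))]
        refine integral_congr_ae (Eventually.of_forall fun x => ?_)
        have := IsTestFunction.partialDeriv_add φ.2 ψ.2 i x
        change F x * partialDeriv i (fun x => φ.1 x + ψ.1 x) x = _
        rw [this, mul_add]
      map_smul' := fun c φ => by
        rw [RingHom.id_apply, smul_eq_mul, ← integral_const_mul]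
        refine integral_congr_ae (Eventually.of_forall fun x => ?_)
        have := IsTestFunction.partialDeriv_const_mul φ.2 c i x
        change F x * partialDeriv i (fun x => c * φ.1 x) x = _
        rw [this]
        ring }
  obtain ⟨g, hg⟩ := exists_inner_eq_of_abs_le J l (eLpNorm w 2 (volume.restrict Ω)).toReal
    (fun φ => by
      refine (hb _ φ.2).trans ?_
      have h1 := abs_integral_mul_le_eLpNorm_two hw (φ.2.memLp 2).abs
      refine (le_abs_self _).trans (h1.trans (le_of_eq ?_))
      rw [ENNReal.toReal_mul]
      congr 1
      change _ = ‖(φ.2.memLp 2).toLp φ.1‖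
      rw [Lp.norm_toLp]
      exact congrArg ENNReal.toReal (eLpNorm_norm φ.1))
  refine ⟨fun x => -g x, (Lp.memLp g).neg, fun φ hφ => ?_⟩
  have h1 := hg ⟨φ, hφ⟩
  rw [L2.inner_def] at h1
  refine h1.trans ?_
  rw [← integral_neg]
  refine integral_congr_ae ?_
  filter_upwards [(hφ.memLp 2).coeFn_toLp] with x hx
  change inner ℝ (g x) ((hφ.memLp 2).toLp φ x) = _
  rw [hx]
  simp [mul_comm]

/-- If `|∫ g φ| ≤ ∫ w |φ|` for all test functions `φ`, then `|g| ≤ w` a.e. -/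
theorem ae_abs_le_of_test_bound (hΩ : IsOpen Ω) {g w : EuclideanSpace ℝ (Fin d) → ℝ}
    (hg : Integrable g (volume.restrict Ω)) (hw : Integrable w (volume.restrict Ω))
    (hb : ∀ φ, IsTestFunction Ω φ → |∫ x in Ω, g x * φ x| ≤ ∫ x in Ω, w x * |φ x|) :
    ∀ᵐ x ∂(volume.restrict Ω), |g x| ≤ w x := by
  -- The radii shrink with fixed ratio 2; a bounded ratio is what a.e. convergence of the
  -- mollifications of a locally integrable function requires.
  let b : ℕ → ContDiffBump (0 : EuclideanSpace ℝ (Fin d)) := fun n =>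
    { rIn := 1 / ((n : ℝ) + 1)
      rOut := 2 * (1 / ((n : ℝ) + 1))
      rIn_pos := by positivity
      rIn_lt_rOut := by
        have : 0 < 1 / ((n : ℝ) + 1) := by positivity
        linarith }
  have hb0 : Tendsto (fun n => (b n).rOut) atTop (𝓝 0) := by
    have := (tendsto_one_div_add_atTop_nhds_zero_nat (𝕜 := ℝ)).const_mul 2
    rwa [mul_zero] at this
  have hbK : ∀ᶠ n in atTop, (b n).rOut ≤ 2 * (b n).rIn := Eventually.of_forall fun n => le_rfl
  have hgi : Integrable (Ω.indicator g) := (integrable_indicator_iff hΩ.measurableSet).2 hg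
  have hwi : Integrable (Ω.indicator w) := (integrable_indicator_iff hΩ.measurableSet).2 hw
  have cg := ContDiffBump.ae_convolution_tendsto_right_of_locallyIntegrable (μ := volume)
    hb0 hbK hgi.locallyIntegrable
  have cw := ContDiffBump.ae_convolution_tendsto_right_of_locallyIntegrable (μ := volume)
    hb0 hbK hwi.locallyIntegrable
  have key : ∀ (h : EuclideanSpace ℝ (Fin d) → ℝ) (n : ℕ) (x : EuclideanSpace ℝ (Fin d)),
      convolution ((b n).normed volume) (Ω.indicator h) (ContinuousLinearMap.lsmul ℝ ℝ) volume x
        = ∫ y in Ω, h y * (b n).normed volume (x - y) := fun h n x => by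
    rw [convolution_eq_swap, ← integral_indicator hΩ.measurableSet]
    refine integral_congr_ae (Eventually.of_forall fun y => ?_)
    by_cases hy : y ∈ Ω <;> simp [hy, mul_comm]
  rw [ae_restrict_iff' hΩ.measurableSet]
  filter_upwards [cg, cw] with x hgx hwx hx
  rw [Set.indicator_of_mem hx] at hgx hwx
  refine le_of_tendsto_of_tendsto hgx.abs hwx ?_
  -- For x ∈ Ω and n large, the bump centred at x is supported inside Ω. It is then a nonnegative
  -- test function, and the hypothesis compares the two mollifications at x.
  obtain ⟨ε, hε, hball⟩ := Metric.isOpen_iff.1 hΩ x hx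
  filter_upwards [hb0.eventually (gt_mem_nhds hε)] with n hn
  have hts : tsupport (fun y => (b n).normed volume (x - y)) ⊆ Metric.closedBall x (b n).rOut := by
    refine closure_minimal (fun y hy => ?_) Metric.isClosed_closedBall
    have h1 : x - y ∈ Function.support ((b n).normed volume) := hy
    rw [ContDiffBump.support_normed_eq, mem_ball_zero_iff] at h1
    rw [mem_closedBall_iff_norm, norm_sub_rev]
    exact h1.le
  have ht : IsTestFunction Ω (fun y => (b n).normed volume (x - y)) :=
    { contDiff := (b n).contDiff_normed.comp (contDiff_const.sub contDiff_id)
      hasCompactSupport := (isCompact_closedBall x _).of_isClosed_subset (isClosed_tsupport _) hts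
      tsupport_subset := hts.trans ((Metric.closedBall_subset_ball hn).trans hball) }
  have := hb _ ht
  simp only [key]
  refine this.trans (le_of_eq ?_)
  refine integral_congr_ae (Eventually.of_forall fun y => ?_)
  simp only [abs_of_nonneg ((b n).nonneg_normed _)]

/-- The difference quotients satisfy the bound. Where the composition has no directional derivative,
`lineDeriv` is 0 by convention, so no exceptional set arises. -/
theorem abs_lineDeriv_comp_le {f : ℝ → ℝ} {K : NNReal} (hf : LipschitzWith K f)
    {φ : EuclideanSpace ℝ (Fin d) → ℝ} {x e : EuclideanSpace ℝ (Fin d)}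
    (hφ : DifferentiableAt ℝ φ x) :
    |lineDeriv ℝ (fun y => f (φ y)) x e| ≤ K * |lineDeriv ℝ φ x e| := by
  by_cases hd : LineDifferentiableAt ℝ (fun y => f (φ y)) x e
  · have h1 := (hasDerivAt_iff_tendsto_slope_zero.1 hd.hasLineDerivAt).abs
    have h2 := (hasDerivAt_iff_tendsto_slope_zero.1
      (hφ.lineDifferentiableAt (v := e)).hasLineDerivAt).abs.const_mul (K : ℝ)
    refine le_of_tendsto_of_tendsto h1 h2 (Eventually.of_forall fun t => ?_)
    have := hf.dist_le_mul (φ (x + (0 + t) • e)) (φ (x + (0 : ℝ) • e))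
    simp only [Real.dist_eq] at this
    simp only [smul_eq_mul, abs_mul]
    calc _ ≤ |t⁻¹| * (K * _) := mul_le_mul_of_nonneg_left this (abs_nonneg _)
      _ = _ := by ring
  · rw [lineDeriv_zero_of_not_lineDifferentiableAt hd]
    simp only [abs_zero]
    positivity

/-- Integration by parts moves the derivative onto the Lipschitz function f ∘ φ, whose partial
derivative is at most K|∂_i φ|. Unlike a formula for that derivative, this estimate passes directly
to limits in φ. -/
theorem IsTestFunction.abs_setIntegral_comp_mul_partialDeriv_le {f : ℝ → ℝ} {K : NNReal}
    (hf : LipschitzWith K f) {φ ψ : EuclideanSpace ℝ (Fin d) → ℝ}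
    (hφ : IsTestFunction Ω φ) (hψ : IsTestFunction Ω ψ) (i : Fin d) :
    |∫ x in Ω, f (φ x) * partialDeriv i ψ x| ≤ ∫ x in Ω, (K * |partialDeriv i φ x|) * |ψ x| := by
  obtain ⟨C, hC⟩ := hφ.exists_lipschitz
  have h1 := hψ.setIntegral_lipschitz_mul_partialDeriv i (hf.comp hC)
  simp only [Function.comp_def] at h1
  rw [h1, abs_neg]
  refine norm_integral_le_of_norm_le ?_ (Eventually.of_forall fun x => ?_)
    (f := fun x => lineDeriv ℝ (fun y => f (φ y)) x (EuclideanSpace.single i 1) * ψ x)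
  · exact integrable_mul_of_memLp_two ((hφ.memLp_partialDeriv i 2).abs.const_mul (K : ℝ))
      (hψ.memLp 2).abs
  · rw [Real.norm_eq_abs, abs_mul]
    refine mul_le_mul_of_nonneg_right ?_ (abs_nonneg _)
    have := abs_lineDeriv_comp_le hf (hφ.differentiable x) (e := EuclideanSpace.single i 1)
    rwa [hφ.lineDeriv_eq] at this

theorem MemW10.abs_setIntegral_comp_mul_partialDeriv_le
    [IsFiniteMeasure (volume.restrict Ω)] (hΩ : IsOpen Ω) (hp : 2 < p) {f : ℝ → ℝ} {K : NNReal}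
    (hf : LipschitzWith K f) (h0 : f 0 = 0) (hu : MemW10 Ω p u)
    {ψ : EuclideanSpace ℝ (Fin d) → ℝ} (hψ : IsTestFunction Ω ψ) (i : Fin d) :
    |∫ x in Ω, f (u x) * partialDeriv i ψ x| ≤
      ∫ x in Ω, (K * |weakPartial Ω i u x|) * |ψ x| := by
  have hP := two_le_ofReal hp
  obtain ⟨φ, hφ, hφ0, hφ1⟩ := hu.exists_approx
  have mf : ∀ {w : EuclideanSpace ℝ (Fin d) → ℝ}, MemLp w (ENNReal.ofReal p) (volume.restrict Ω) →
      MemLp (fun x => f (w x)) (ENNReal.ofReal p) (volume.restrict Ω) := fun {w} hw => by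
    refine hw.of_le_mul (c := K) (hf.continuous.comp_aestronglyMeasurable hw.1)
      (Eventually.of_forall fun x => ?_)
    have := hf.dist_le_mul (w x) 0
    simpa [h0] using this
  have l0 := tendsto_integral_mul_of_tendsto_eLpNorm hP (fun n => mf ((hφ n).memLp _))
    (mf hu.memW1.memLp) (hψ.memLp_partialDeriv i 2)
    (tendsto_eLpNorm_zero_of_le_mul (C := K)
      (fun n => Eventually.of_forall fun x => hf.dist_le_mul (u x) (φ n x)) hφ0)
  have l1 := tendsto_integral_mul_of_tendsto_eLpNorm hP
    (fun n => ((hφ n).memLp_partialDeriv i _).abs.const_mul (K : ℝ))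
    ((hu.memW1.memLp_weakPartial hΩ i).abs.const_mul (K : ℝ)) (hψ.memLp 2).abs
    (tendsto_eLpNorm_zero_of_le_mul (C := K) (fun n => Eventually.of_forall fun x => by
      simp only [Pi.abs_apply]
      rw [← mul_sub, norm_mul, Real.norm_eq_abs, NNReal.abs_eq]
      exact mul_le_mul_of_nonneg_left (abs_abs_sub_abs_le _ _) K.2) (hφ1 i))
  exact le_of_tendsto_of_tendsto l0.abs l1 (Eventually.of_forall fun n =>
    (hφ n).abs_setIntegral_comp_mul_partialDeriv_le hf hψ i)

/-- Lipschitz functions vanishing at `0` map `W_0^{1,p}(Ω)` to `W^{1,p}(Ω)`. -/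
theorem MemW10.memW1_comp_lipschitz [IsFiniteMeasure (volume.restrict Ω)] (hΩ : IsOpen Ω)
    (hp : 2 < p) {f : ℝ → ℝ} {K : NNReal} (hf : LipschitzWith K f) (h0 : f 0 = 0)
    (hu : MemW10 Ω p u) : MemW1 Ω p (fun x => f (u x)) := by
  have hP := two_le_ofReal hp
  have hP1 : 1 ≤ ENNReal.ofReal p := le_trans (by norm_num) hP
  have mf : MemLp (fun x => f (u x)) (ENNReal.ofReal p) (volume.restrict Ω) := by
    refine hu.memW1.memLp.of_le_mul (c := K)
      (hf.continuous.comp_aestronglyMeasurable hu.memW1.memLp.1)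
      (Eventually.of_forall fun x => ?_)
    have := hf.dist_le_mul (u x) 0
    simpa [h0] using this
  refine ⟨mf, fun i => ?_⟩
  have hw : MemLp (fun x => K * |weakPartial Ω i u x|) (ENNReal.ofReal p) (volume.restrict Ω) :=
    (hu.memW1.memLp_weakPartial hΩ i).abs.const_mul (K : ℝ)
  obtain ⟨g, hg, hgφ⟩ := exists_memLp_two_of_test_bound (mf.mono_exponent hP)
    (hw.mono_exponent hP) (fun φ hφ =>
      hu.abs_setIntegral_comp_mul_partialDeriv_le hΩ hp hf h0 hφ i)
  -- The Riesz representative is a priori only in L²; the pointwise bound by K|∂_i u| lifts it to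
  -- L^p.
  have hle := ae_abs_le_of_test_bound hΩ (hg.integrable (by norm_num)) (hw.integrable hP1)
    (fun φ hφ => by
      rw [← abs_neg, ← hgφ φ hφ]
      exact hu.abs_setIntegral_comp_mul_partialDeriv_le hΩ hp hf h0 hφ i)
  have hgp : MemLp g (ENNReal.ofReal p) (volume.restrict Ω) := by
    refine hw.mono hg.1 ?_
    filter_upwards [hle] with x hx
    exact hx.trans (le_abs_self _)
  exact ⟨g, ⟨locallyIntegrableOn_of_memLp hP1 mf,
    locallyIntegrableOn_of_memLp hP1 hgp, hgφ⟩, hgp⟩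

end

/-! ### The smooth approximations arctan(k r) of (π/2) sgn r. -/

section Sigmoid

theorem contDiff_arctan_mul (k : ℕ) : ContDiff ℝ (⊤ : ℕ∞) fun r : ℝ => Real.arctan (k * r) :=
  Real.contDiff_arctan.comp (contDiff_const.mul contDiff_id)

theorem deriv_arctan_mul (k : ℕ) (r : ℝ) :
    deriv (fun r : ℝ => Real.arctan (k * r)) r = k / (1 + (k * r) ^ 2) := by
  have h : HasDerivAt (fun r : ℝ => (k : ℝ) * r) k r := by
    simpa using (hasDerivAt_id r).const_mul (k : ℝ)
  rw [h.arctan.deriv]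
  ring

theorem deriv_arctan_mul_nonneg (k : ℕ) (r : ℝ) :
    0 ≤ deriv (fun r : ℝ => Real.arctan (k * r)) r := by
  rw [deriv_arctan_mul]
  positivity

theorem norm_deriv_arctan_mul_le (k : ℕ) (r : ℝ) :
    ‖deriv (fun r : ℝ => Real.arctan (k * r)) r‖ ≤ (k : NNReal) := by
  rw [Real.norm_of_nonneg (deriv_arctan_mul_nonneg k r), deriv_arctan_mul]
  refine div_le_self (by positivity) ?_
  nlinarith [sq_nonneg ((k : ℝ) * r)]

theorem lipschitzWith_arctan_mul (k : ℕ) :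
    LipschitzWith k fun r : ℝ => Real.arctan (k * r) :=
  lipschitzWith_of_nnnorm_deriv_le ((contDiff_arctan_mul k).differentiable (by simp))
    (norm_deriv_arctan_mul_le k)

theorem abs_arctan_le (r : ℝ) : |Real.arctan r| ≤ Real.pi / 2 :=
  abs_le.2 ⟨(Real.neg_pi_div_two_lt_arctan r).le, (Real.arctan_lt_pi_div_two r).le⟩

theorem tendsto_arctan_mul (r : ℝ) :
    Tendsto (fun k : ℕ => Real.arctan (k * r)) atTop (𝓝 (Real.pi / 2 * Real.sign r)) := by
  rcases lt_trichotomy r 0 with h | h | h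
  · rw [Real.sign_of_neg h, mul_neg_one]
    exact (Real.tendsto_arctan_atBot.mono_right nhdsWithin_le_nhds).comp
      (tendsto_natCast_atTop_atTop.atTop_mul_const_of_neg h)
  · simp [h]
  · rw [Real.sign_of_pos h, mul_one]
    exact (Real.tendsto_arctan_atTop.mono_right nhdsWithin_le_nhds).comp
      (tendsto_natCast_atTop_atTop.atTop_mul_const h)

/-- This is k|r| ≤ 1 + (kr)², a consequence of (k|r| − 1)² ≥ 0. Being uniform in k, it supplies the
majorant for the flux term. -/
theorem abs_mul_deriv_arctan_mul_le (k : ℕ) (r : ℝ) :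
    |r| * deriv (fun r : ℝ => Real.arctan (k * r)) r ≤ 1 := by
  rw [deriv_arctan_mul, ← mul_div_assoc, div_le_one (by positivity), ← sq_abs ((k : ℝ) * r),
    abs_mul, Nat.abs_cast]
  nlinarith [sq_nonneg ((k : ℝ) * |r| - 1), abs_nonneg r, (Nat.cast_nonneg k : (0 : ℝ) ≤ k)]

/-- For r ≠ 0 the quantity is at most 1/(k|r|); at r = 0, where the derivative grows like k, the
factor |r| removes it. -/
theorem tendsto_abs_mul_deriv_arctan_mul (r : ℝ) :
    Tendsto (fun k : ℕ => |r| * deriv (fun r : ℝ => Real.arctan (k * r)) r) atTop (𝓝 0) := by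
  rcases eq_or_ne r 0 with rfl | h
  · simp
  have hr : 0 < |r| := abs_pos.2 h
  have h0 := (tendsto_inv_atTop_nhds_zero_nat (𝕜 := ℝ)).const_mul (|r|⁻¹)
  rw [mul_zero] at h0
  refine squeeze_zero (fun k => mul_nonneg hr.le (deriv_arctan_mul_nonneg k r)) (fun k => ?_) h0
  rcases Nat.eq_zero_or_pos k with rfl | hk
  · simp
  have hk' : (0 : ℝ) < k := by exact_mod_cast hk
  rw [deriv_arctan_mul, ← mul_div_assoc, ← mul_inv, ← one_div, div_le_div_iff₀ (by positivity)
    (by positivity), ← sq_abs ((k : ℝ) * r), abs_mul, Nat.abs_cast]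
  nlinarith

end Sigmoid

/-! ### Elementary inequalities for a ↦ |a|^{q−2} a. -/

section Monotonicity

theorem rpow_sub_two_mul_self {q : ℝ} (hq : 1 < q) {a : ℝ} (ha : 0 ≤ a) :
    a ^ (q - 2) * a = a ^ (q - 1) := by
  rcases ha.eq_or_lt with rfl | h
  · rw [mul_zero, Real.zero_rpow (by linarith)]
  · nth_rewrite 2 [← Real.rpow_one a]
    rw [← Real.rpow_add h]
    congr 1
    ring

/-- Replace the smaller of a, b by the larger. This crude form of Young's inequality suffices for
the integrability of both energy pairings. -/
theorem rpow_sub_two_mul_mul_le {q : ℝ} (hq : 1 < q) {a b : ℝ} (ha : 0 ≤ a) (hb : 0 ≤ b) :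
    a ^ (q - 2) * a * b ≤ a ^ q + b ^ q := by
  rw [rpow_sub_two_mul_self hq ha]
  have key : ∀ {c : ℝ}, 0 ≤ c → c ^ (q - 1) * c = c ^ q := fun {c} hc => by
    rcases hc.eq_or_lt with rfl | h
    · rw [mul_zero, Real.zero_rpow (by linarith)]
    · nth_rewrite 2 [← Real.rpow_one c]
      rw [← Real.rpow_add h]
      congr 1
      ring
  rcases le_total a b with h | h
  · calc a ^ (q - 1) * b ≤ b ^ (q - 1) * b :=
          mul_le_mul_of_nonneg_right (Real.rpow_le_rpow ha h (by linarith)) hb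
      _ = b ^ q := key hb
      _ ≤ _ := le_add_of_nonneg_left (Real.rpow_nonneg ha _)
  · calc a ^ (q - 1) * b ≤ a ^ (q - 1) * a :=
          mul_le_mul_of_nonneg_left h (Real.rpow_nonneg ha _)
      _ = a ^ q := key ha
      _ ≤ _ := le_add_of_nonneg_right (Real.rpow_nonneg hb _)

/-- Monotonicity of `a ↦ |a|^{q-2} a`. -/
theorem inner_rpow_smul_sub_nonneg {H : Type*} [NormedAddCommGroup H] [InnerProductSpace ℝ H]
    {q : ℝ} (hq : 1 < q) (a b : H) :
    0 ≤ ‖a‖ ^ (q - 2) * inner ℝ a (a - b) - ‖b‖ ^ (q - 2) * inner ℝ b (a - b) := by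
  have hA : 0 ≤ ‖a‖ ^ (q - 2) := Real.rpow_nonneg (norm_nonneg _) _
  have hB : 0 ≤ ‖b‖ ^ (q - 2) := Real.rpow_nonneg (norm_nonneg _) _
  have hab : inner ℝ a b ≤ ‖a‖ * ‖b‖ := real_inner_le_norm a b
  rw [inner_sub_right, inner_sub_right, real_inner_self_eq_norm_sq, real_inner_self_eq_norm_sq,
    real_inner_comm a b]
  -- By Cauchy–Schwarz this product is a lower bound for the goal, which reduces matters to the
  -- monotonicity of t ↦ t^{q−1} on [0, ∞).
  have hm : 0 ≤ (‖a‖ ^ (q - 2) * ‖a‖ - ‖b‖ ^ (q - 2) * ‖b‖) * (‖a‖ - ‖b‖) := by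
    rw [rpow_sub_two_mul_self hq (norm_nonneg _), rpow_sub_two_mul_self hq (norm_nonneg _)]
    rcases le_total ‖a‖ ‖b‖ with h | h
    · exact mul_nonneg_of_nonpos_of_nonpos
        (sub_nonpos.2 (Real.rpow_le_rpow (norm_nonneg _) h (by linarith))) (sub_nonpos.2 h)
    · exact mul_nonneg
        (sub_nonneg.2 (Real.rpow_le_rpow (norm_nonneg _) h (by linarith))) (sub_nonneg.2 h)
  nlinarith [mul_le_mul_of_nonneg_left hab hA, mul_le_mul_of_nonneg_left hab hB]

theorem abs_rpow_mul_sub_mul_nonneg {q : ℝ} (hq : 1 < q) {a b c : ℝ}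
    (h1 : b ≤ a → 0 ≤ c) (h2 : a ≤ b → c ≤ 0) :
    0 ≤ (|a| ^ (q - 2) * a - |b| ^ (q - 2) * b) * c := by
  have h := inner_rpow_smul_sub_nonneg hq a b
  simp only [Real.norm_eq_abs, RCLike.inner_apply, conj_trivial] at h
  rcases lt_trichotomy a b with hab | rfl | hab
  · refine mul_nonneg_of_nonpos_of_nonpos ?_ (h2 hab.le)
    by_contra! hc
    nlinarith [mul_pos hc (sub_pos.2 hab)]
  · simp
  · refine mul_nonneg ?_ (h1 hab.le)
    by_contra! hc
    nlinarith [mul_pos (neg_pos.2 hc) (sub_pos.2 hab)]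

end Monotonicity

/-! ### The space W_0^{s,q} and monotonicity of the fractional pairing. -/

section Fractional

variable {d : ℕ} {Ω : Set (EuclideanSpace ℝ (Fin d))} {s q : ℝ}
  {u v : EuclideanSpace ℝ (Fin d) → ℝ}

theorem aestronglyMeasurable_fst_sub_snd (hu : AEStronglyMeasurable u volume) :
    AEStronglyMeasurable
      (fun z : EuclideanSpace ℝ (Fin d) × EuclideanSpace ℝ (Fin d) => u z.1 - u z.2) volume :=
  (hu.comp_fst (ν := volume)).sub (hu.comp_snd (μ := volume))

theorem measurable_norm_fst_sub_snd_rpow (e : ℝ) :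
    Measurable fun z : EuclideanSpace ℝ (Fin d) × EuclideanSpace ℝ (Fin d) =>
      ‖z.1 - z.2‖ ^ e :=
  (continuous_fst.sub continuous_snd).norm.measurable.pow_const e

theorem aestronglyMeasurable_gagliardo (hu : AEStronglyMeasurable u volume) (e : ℝ) :
    AEStronglyMeasurable (fun z : EuclideanSpace ℝ (Fin d) × EuclideanSpace ℝ (Fin d) =>
      |u z.1 - u z.2| ^ q / ‖z.1 - z.2‖ ^ e) volume :=
  (((aestronglyMeasurable_fst_sub_snd hu).norm.aemeasurable.pow_const q).div
    (measurable_norm_fst_sub_snd_rpow e).aemeasurable).aestronglyMeasurable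

theorem gagliardo_nonneg (u : EuclideanSpace ℝ (Fin d) → ℝ) (q e : ℝ)
    (z : EuclideanSpace ℝ (Fin d) × EuclideanSpace ℝ (Fin d)) :
    0 ≤ |u z.1 - u z.2| ^ q / ‖z.1 - z.2‖ ^ e := by
  positivity

theorem MemWs0.integrable (hu : MemWs0 Ω s q u) :
    Integrable (fun z : EuclideanSpace ℝ (Fin d) × EuclideanSpace ℝ (Fin d) =>
      |u z.1 - u z.2| ^ q / ‖z.1 - z.2‖ ^ ((d : ℝ) + s * q)) volume :=
  ⟨aestronglyMeasurable_gagliardo hu.memLp.1 _,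
    (hasFiniteIntegral_iff_ofReal (Eventually.of_forall (gagliardo_nonneg u q _))).2
      hu.seminorm_lt_top⟩

theorem lintegral_gagliardo_lt_top_of_le {w : EuclideanSpace ℝ (Fin d) → ℝ} {e : ℝ}
    {g : EuclideanSpace ℝ (Fin d) × EuclideanSpace ℝ (Fin d) → ℝ}
    (hg : Integrable g volume)
    (h : ∀ z, |w z.1 - w z.2| ^ q / ‖z.1 - z.2‖ ^ e ≤ g z) :
    ∫⁻ z : EuclideanSpace ℝ (Fin d) × EuclideanSpace ℝ (Fin d),
      ENNReal.ofReal (|w z.1 - w z.2| ^ q / ‖z.1 - z.2‖ ^ e) < ⊤ :=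
  (lintegral_mono fun z => ENNReal.ofReal_le_ofReal (h z)).trans_lt
    ((hasFiniteIntegral_iff_ofReal (Eventually.of_forall fun z =>
      (gagliardo_nonneg w q e z).trans (h z))).1 hg.2)

theorem abs_sub_rpow_le {q : ℝ} (hq : 1 < q) (a b : ℝ) :
    |a - b| ^ q ≤ 2 ^ q * (|a| ^ q + |b| ^ q) := by
  have h0 : |a - b| ≤ 2 * max |a| |b| := by
    have := abs_sub a b
    linarith [le_max_left |a| |b|, le_max_right |a| |b|]
  have hm : 0 ≤ max |a| |b| := le_max_of_le_left (abs_nonneg a)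
  calc |a - b| ^ q ≤ (2 * max |a| |b|) ^ q := Real.rpow_le_rpow (abs_nonneg _) h0 (by linarith)
    _ = 2 ^ q * (max |a| |b|) ^ q := Real.mul_rpow (by norm_num) hm
    _ ≤ _ := by
      refine mul_le_mul_of_nonneg_left ?_ (by positivity)
      rcases max_choice |a| |b| with h | h <;> rw [h]
      · exact le_add_of_nonneg_right (by positivity)
      · exact le_add_of_nonneg_left (by positivity)

theorem MemWs0.sub (hq : 1 < q) (hu : MemWs0 Ω s q u) (hv : MemWs0 Ω s q v) :
    MemWs0 Ω s q (fun x => u x - v x) where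
  memLp := hu.memLp.sub hv.memLp
  seminorm_lt_top := by
    refine lintegral_gagliardo_lt_top_of_le (w := fun x => u x - v x)
      ((hu.integrable.add hv.integrable).const_mul ((2 : ℝ) ^ q)) fun z => ?_
    simp only [Pi.add_apply]
    rw [← add_div, ← mul_div_assoc]
    refine div_le_div_of_nonneg_right ?_ (by positivity)
    have := abs_sub_rpow_le hq (u z.1 - u z.2) (v z.1 - v z.2)
    rwa [sub_sub_sub_comm] at this
  ae_eq_zero := by
    filter_upwards [hu.ae_eq_zero, hv.ae_eq_zero] with x h1 h2
    rw [h1, h2, sub_zero]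

theorem MemWs0.comp (hq : 1 < q) (hu : MemWs0 Ω s q u) {T : ℝ → ℝ} {C : NNReal}
    (hT : LipschitzWith C T) (h0 : T 0 = 0) : MemWs0 Ω s q (fun x => T (u x)) where
  memLp := by
    refine hu.memLp.of_le_mul (c := C) (hT.continuous.comp_aestronglyMeasurable hu.memLp.1)
      (Eventually.of_forall fun x => ?_)
    have := hT.dist_le_mul (u x) 0
    simpa [h0] using this
  seminorm_lt_top := by
    refine lintegral_gagliardo_lt_top_of_le (w := fun x => T (u x))
      (hu.integrable.const_mul ((C : ℝ) ^ q)) fun z => ?_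
    rw [← mul_div_assoc]
    refine div_le_div_of_nonneg_right ?_ (by positivity)
    rw [← Real.mul_rpow C.coe_nonneg (abs_nonneg _)]
    exact Real.rpow_le_rpow (abs_nonneg _) (hT.dist_le_mul (u z.1) (u z.2)) (by linarith)
  ae_eq_zero := by
    filter_upwards [hu.ae_eq_zero] with x h1
    rw [h1, h0]

theorem MemWs0.integrable_fracPairing (hq : 1 < q) (hu : MemWs0 Ω s q u)
    (hv : MemWs0 Ω s q v) :
    Integrable (fun z : EuclideanSpace ℝ (Fin d) × EuclideanSpace ℝ (Fin d) =>
      |u z.1 - u z.2| ^ (q - 2) * (u z.1 - u z.2) * (v z.1 - v z.2) /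
        ‖z.1 - z.2‖ ^ ((d : ℝ) + s * q)) volume := by
  have mu := (aestronglyMeasurable_fst_sub_snd hu.memLp.1).aemeasurable
  have mv := (aestronglyMeasurable_fst_sub_snd hv.memLp.1).aemeasurable
  refine (hu.integrable.add hv.integrable).mono'
    ((((mu.norm.pow_const (q - 2)).mul mu).mul mv).div
      (measurable_norm_fst_sub_snd_rpow _).aemeasurable).aestronglyMeasurable
    (Eventually.of_forall fun z => ?_)
  simp only [Pi.add_apply]
  rw [← add_div, Real.norm_eq_abs, abs_div, abs_mul, abs_mul,
    abs_of_nonneg (Real.rpow_nonneg (abs_nonneg _) _),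
    abs_of_nonneg (Real.rpow_nonneg (norm_nonneg _) _)]
  exact div_le_div_of_nonneg_right
    (rpow_sub_two_mul_mul_le hq (abs_nonneg _) (abs_nonneg _)) (by positivity)

/-- With a = u(x) − u(y), b = v(x) − v(y) and w = u − v, one has a − b = w(x) − w(y). Hence T(w(x))
− T(w(y)) is ≥ 0 when a ≥ b and ≤ 0 when a ≤ b, and the integrand is pointwise nonnegative. -/
theorem fracPairing_sub_nonneg (hq : 1 < q) (hu : MemWs0 Ω s q u) (hv : MemWs0 Ω s q v)
    {T : ℝ → ℝ} {C : NNReal} (hT : LipschitzWith C T) (hmono : Monotone T) (h0 : T 0 = 0) :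
    0 ≤ fracPairing s q u (fun x => T (u x - v x)) -
      fracPairing s q v (fun x => T (u x - v x)) := by
  have hφ := (hu.sub hq hv).comp hq hT h0
  rw [fracPairing, fracPairing, ← integral_sub (hu.integrable_fracPairing hq hφ)
    (hv.integrable_fracPairing hq hφ)]
  refine integral_nonneg fun z => ?_
  simp only [Pi.zero_apply]
  rw [← sub_div, ← sub_mul]
  refine div_nonneg (abs_rpow_mul_sub_mul_nonneg hq (fun h => ?_) fun h => ?_) (by positivity)
  · exact sub_nonneg.2 (hmono (by linarith))
  · exact sub_nonpos.2 (hmono (by linarith))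

end Fractional

/-! ### Monotonicity of the p-Laplace pairing. -/

section PLaplace

variable {d : ℕ} {Ω : Set (EuclideanSpace ℝ (Fin d))} {p : ℝ}
  {u v : EuclideanSpace ℝ (Fin d) → ℝ}

theorem MemW1.memLp_weakGrad (hΩ : IsOpen Ω) (hu : MemW1 Ω p u) :
    MemLp (weakGrad Ω u) (ENNReal.ofReal p) (volume.restrict Ω) := by
  have e : weakGrad Ω u = fun x => ∑ i, ContinuousLinearMap.toSpanSingleton ℝ
      (EuclideanSpace.single i (1 : ℝ)) (weakPartial Ω i u x) := by
    funext x
    ext j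
    simp [weakGrad, Finset.sum_apply, Pi.single_apply]
  rw [e]
  exact memLp_finsetSum _ fun i _ =>
    (ContinuousLinearMap.toSpanSingleton ℝ (EuclideanSpace.single i (1 : ℝ))).comp_memLp'
      (hu.memLp_weakPartial hΩ i)

theorem MemW1.integrable_norm_weakGrad_rpow (hΩ : IsOpen Ω) (hp : 2 < p) (hu : MemW1 Ω p u) :
    Integrable (fun x => ‖weakGrad Ω u x‖ ^ p) (volume.restrict Ω) := by
  have := (hu.memLp_weakGrad hΩ).integrable_norm_rpow (by simp; linarith) ENNReal.ofReal_ne_top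
  rwa [ENNReal.toReal_ofReal (by linarith)] at this

theorem MemW1.integrable_pLaplacePairing (hΩ : IsOpen Ω) (hp : 2 < p) (hu : MemW1 Ω p u)
    (hv : MemW1 Ω p v) :
    Integrable (fun x => ‖weakGrad Ω u x‖ ^ (p - 2) *
      inner ℝ (weakGrad Ω u x) (weakGrad Ω v x)) (volume.restrict Ω) := by
  have mu := (hu.memLp_weakGrad hΩ).1
  have mv := (hv.memLp_weakGrad hΩ).1
  refine ((hu.integrable_norm_weakGrad_rpow hΩ hp).add
    (hv.integrable_norm_weakGrad_rpow hΩ hp)).mono'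
    ((mu.norm.aemeasurable.pow_const (p - 2)).aestronglyMeasurable.mul (mu.inner mv))
    (Eventually.of_forall fun x => ?_)
  simp only [Pi.add_apply]
  rw [Real.norm_eq_abs, abs_mul, abs_of_nonneg (Real.rpow_nonneg (norm_nonneg _) _)]
  refine le_trans ?_ (rpow_sub_two_mul_mul_le (by linarith) (norm_nonneg _) (norm_nonneg _))
  rw [mul_assoc]
  exact mul_le_mul_of_nonneg_left (abs_real_inner_le_norm _ _)
    (Real.rpow_nonneg (norm_nonneg _) _)

/-- The chain rule gives ∇T(u − v) = T'(u − v)(∇u − ∇v), so the integrand is T' ≥ 0 times the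
monotonicity expression for a ↦ |a|^{p−2} a at ∇u, ∇v. -/
theorem pLaplacePairing_sub_nonneg [IsFiniteMeasure (volume.restrict Ω)] (hΩ : IsOpen Ω)
    (hp : 2 < p) (hu : MemW10 Ω p u) (hv : MemW10 Ω p v) {T : ℝ → ℝ}
    (hT : ContDiff ℝ (⊤ : ℕ∞) T) (h0 : T 0 = 0) {C : NNReal} (hC : ∀ t, ‖deriv T t‖ ≤ C)
    (hT' : ∀ t, 0 ≤ deriv T t) :
    0 ≤ pLaplacePairing Ω p u (fun x => T (u x - v x)) -
      pLaplacePairing Ω p v (fun x => T (u x - v x)) := by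
  obtain ⟨hφ, hφ'⟩ := (hu.sub hΩ hp hv).comp hΩ hp hT h0 hC
  rw [pLaplacePairing, pLaplacePairing,
    ← integral_sub (hu.memW1.integrable_pLaplacePairing hΩ hp hφ.memW1)
      (hv.memW1.integrable_pLaplacePairing hΩ hp hφ.memW1)]
  refine integral_nonneg_of_ae ?_
  have hsub := fun i => hu.memW1.weakPartial_sub_ae_eq hΩ hv.memW1 i
  filter_upwards [ae_all_iff.2 hφ', ae_all_iff.2 hsub] with x h1 h2
  have e : weakGrad Ω (fun x => T (u x - v x)) x =
      deriv T (u x - v x) • (weakGrad Ω u x - weakGrad Ω v x) := by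
    ext i
    simp [weakGrad, h1 i, h2 i]
  have := mul_nonneg (hT' (u x - v x))
    (inner_rpow_smul_sub_nonneg (q := p) (by linarith) (weakGrad Ω u x) (weakGrad Ω v x))
  rw [e, inner_smul_right, inner_smul_right]
  refine this.trans (le_of_eq ?_)
  ring

end PLaplace

/-! ### The flux term and the sign identity. -/

section Flux

variable {d : ℕ} {Ω : Set (EuclideanSpace ℝ (Fin d))} {p : ℝ}
  {u v : EuclideanSpace ℝ (Fin d) → ℝ}

/-- The Lipschitz bound |f(u) − f(v)| ≤ K|u − v| supplies exactly the factor that tames the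
concentrating derivative of arctan(k ·) near u = v. The majorant K|∂_i(u − v)| is integrable since Ω
has finite measure. -/
theorem tendsto_integral_flux_mul_weakPartial_arctan [IsFiniteMeasure (volume.restrict Ω)]
    (hΩ : IsOpen Ω) (hp : 2 < p) (hu : MemW10 Ω p u) (hv : MemW10 Ω p v) {f : ℝ → ℝ}
    {K : NNReal} (hf : LipschitzWith K f) (i : Fin d) :
    Tendsto (fun k : ℕ => ∫ x in Ω, (f (u x) - f (v x)) *
      weakPartial Ω i (fun x => Real.arctan (k * (u x - v x))) x) atTop (𝓝 0) := by
  have hw := hu.sub hΩ hp hv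
  have hP1 : 1 ≤ ENNReal.ofReal p := le_trans (by norm_num) (two_le_ofReal hp)
  have mf : ∀ {w : EuclideanSpace ℝ (Fin d) → ℝ}, MemW10 Ω p w →
      AEStronglyMeasurable (fun x => f (w x)) (volume.restrict Ω) := fun h =>
    hf.continuous.comp_aestronglyMeasurable h.memW1.memLp.1
  have hc := fun k : ℕ => hw.comp hΩ hp (contDiff_arctan_mul k) (by simp)
    (norm_deriv_arctan_mul_le k)
  have hle : ∀ k : ℕ, ∀ᵐ x ∂(volume.restrict Ω), ‖(f (u x) - f (v x)) *
      weakPartial Ω i (fun x => Real.arctan (k * (u x - v x))) x‖ ≤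
      (|u x - v x| * deriv (fun r : ℝ => Real.arctan (k * r)) (u x - v x)) *
        (K * |weakPartial Ω i (fun x => u x - v x) x|) := fun k => by
    filter_upwards [(hc k).2 i] with x hx
    rw [hx, norm_mul, norm_mul, Real.norm_of_nonneg (deriv_arctan_mul_nonneg k _)]
    have h1 : ‖f (u x) - f (v x)‖ ≤ K * |u x - v x| := hf.dist_le_mul _ _
    have h2 := mul_le_mul_of_nonneg_right h1 (mul_nonneg
      (deriv_arctan_mul_nonneg k (u x - v x))
      (norm_nonneg (weakPartial Ω i (fun x => u x - v x) x)))
    refine h2.trans (le_of_eq ?_)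
    rw [Real.norm_eq_abs]
    ring
  rw [← integral_zero (EuclideanSpace ℝ (Fin d)) ℝ (μ := volume.restrict Ω)]
  refine tendsto_integral_of_dominated_convergence
    (fun x => K * |weakPartial Ω i (fun x => u x - v x) x|)
    (fun k => ((mf hu).sub (mf hv)).mul ((hc k).1.memW1.memLp_weakPartial hΩ i).1)
    (((hw.memW1.memLp_weakPartial hΩ i).integrable hP1).abs.const_mul _) (fun k => ?_) ?_
  · filter_upwards [hle k] with x hx
    refine hx.trans (mul_le_of_le_one_left (by positivity) (abs_mul_deriv_arctan_mul_le k _))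
  · filter_upwards [ae_all_iff.2 hle] with x hx
    have := (tendsto_abs_mul_deriv_arctan_mul (u x - v x)).mul_const
      (K * |weakPartial Ω i (fun x => u x - v x) x|)
    rw [zero_mul] at this
    exact squeeze_zero_norm hx this

theorem tendsto_integral_mul_arctan {X : Type*} [MeasurableSpace X] {ν : Measure X}
    {g w : X → ℝ} (hg : Integrable g ν) (hw : AEStronglyMeasurable w ν) :
    Tendsto (fun k : ℕ => ∫ x, g x * Real.arctan (k * w x) ∂ν) atTop
      (𝓝 (Real.pi / 2 * ∫ x, g x * Real.sign (w x) ∂ν)) := by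
  rw [← integral_const_mul]
  refine tendsto_integral_of_dominated_convergence (fun x => |g x| * (Real.pi / 2))
    (fun k => hg.1.mul ((contDiff_arctan_mul k).continuous.comp_aestronglyMeasurable hw))
    (hg.abs.mul_const _) (fun k => Eventually.of_forall fun x => ?_)
    (Eventually.of_forall fun x => ?_)
  · rw [norm_mul]
    exact mul_le_mul_of_nonneg_left (abs_arctan_le _) (norm_nonneg _)
  · have := (tendsto_arctan_mul (w x)).const_mul (g x)
    convert this using 2
    ring

/-- `∫_Ω ∂_i (f(u) - f(v)) sgn(u - v) = 0` on `W_0^{1,p}(Ω)`. -/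
theorem integral_weakPartial_flux_mul_sign [IsFiniteMeasure (volume.restrict Ω)]
    (hΩ : IsOpen Ω) (hp : 2 < p) (hu : MemW10 Ω p u) (hv : MemW10 Ω p v) {f : ℝ → ℝ}
    {K : NNReal} (hf : LipschitzWith K f) (h0 : f 0 = 0) (i : Fin d) :
    ∫ x in Ω, weakPartial Ω i (fun x => f (u x) - f (v x)) x * Real.sign (u x - v x) = 0 := by
  have hF := (hu.memW1_comp_lipschitz hΩ hp hf h0).sub (hv.memW1_comp_lipschitz hΩ hp hf h0)
  have hw := hu.sub hΩ hp hv
  have hP1 : 1 ≤ ENNReal.ofReal p := le_trans (by norm_num) (two_le_ofReal hp)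
  have l1 := (tendsto_integral_flux_mul_weakPartial_arctan hΩ hp hu hv hf i).neg
  have l2 := tendsto_integral_mul_arctan ((hF.memLp_weakPartial hΩ i).integrable hP1)
    hw.memW1.memLp.1
  -- Integration by parts identifies the two sequences; one tends to π/2 times the integral sought,
  -- the other to 0.
  have e := tendsto_nhds_unique l2 (l1.congr fun k => by
    rw [((hw.comp hΩ hp (contDiff_arctan_mul k) (by simp)
      (norm_deriv_arctan_mul_le k)).1).integral_mul_weakPartial hΩ hp hF i, neg_neg])
  rw [neg_zero] at e
  exact (mul_eq_zero.1 e).resolve_left (by positivity)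

end Flux

/-! ### The duality mapping of L¹. -/

section Duality

variable {X : Type*} [MeasurableSpace X] {ν : Measure X}

theorem measurable_sign : Measurable Real.sign :=
  Measurable.ite (measurableSet_lt measurable_id measurable_const) measurable_const
    (Measurable.ite (measurableSet_lt measurable_const measurable_id) measurable_const
      measurable_const)

theorem abs_sign_le_one (r : ℝ) : |Real.sign r| ≤ 1 := by
  rcases Real.sign_apply_eq r with h | h | h <;> simp [h]

/-- The functional `‖z‖ sgn(z)` belongs to the duality mapping of `L^1` at `z`. -/
theorem exists_duality_of_integral_sign_nonneg (z y : Lp ℝ 1 ν)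
    (h : 0 ≤ ∫ x, y x * Real.sign (z x) ∂ν) :
    ∃ w : StrongDual ℝ (Lp ℝ 1 ν), w z = ‖z‖ ^ 2 ∧ ‖w‖ = ‖z‖ ∧ 0 ≤ w y := by
  have ms : AEStronglyMeasurable (fun x => Real.sign (z x)) ν :=
    (measurable_sign.comp_aemeasurable (Lp.aestronglyMeasurable z).aemeasurable)
      |>.aestronglyMeasurable
  have hi : ∀ g : Lp ℝ 1 ν, Integrable (fun x => g x * Real.sign (z x)) ν := fun g =>
    (L1.integrable_coeFn g).mul_bdd (c := 1) ms (Eventually.of_forall fun x => abs_sign_le_one _)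
  let l : Lp ℝ 1 ν →ₗ[ℝ] ℝ :=
    { toFun := fun g => ‖z‖ * ∫ x, g x * Real.sign (z x) ∂ν
      map_add' := fun g g' => by
        rw [← mul_add, ← integral_add (hi g) (hi g')]
        congr 1
        refine integral_congr_ae ?_
        filter_upwards [Lp.coeFn_add g g'] with x hx
        rw [hx, Pi.add_apply, add_mul]
      map_smul' := fun c g => by
        rw [RingHom.id_apply, smul_eq_mul, mul_left_comm, ← integral_const_mul c]
        congr 1
        refine integral_congr_ae ?_
        filter_upwards [Lp.coeFn_smul c g] with x hx
        rw [hx, Pi.smul_apply, smul_eq_mul, mul_assoc] }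
  have hl : ∀ g, ‖l g‖ ≤ ‖z‖ * ‖g‖ := fun g => by
    change ‖‖z‖ * ∫ x, g x * Real.sign (z x) ∂ν‖ ≤ _
    rw [norm_mul, norm_norm]
    refine mul_le_mul_of_nonneg_left ?_ (norm_nonneg _)
    rw [L1.norm_eq_integral_norm]
    refine norm_integral_le_of_norm_le (G := ℝ) (f := fun x => g x * Real.sign (z x))
      (L1.integrable_coeFn g).norm (Eventually.of_forall fun x => ?_)
    simp only [norm_mul]
    exact mul_le_of_le_one_right (norm_nonneg _) (abs_sign_le_one _)
  have hz : l z = ‖z‖ ^ 2 := by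
    change ‖z‖ * ∫ x, z x * Real.sign (z x) ∂ν = _
    rw [sq]
    congr 1
    rw [L1.norm_eq_integral_norm]
    refine integral_congr_ae (Eventually.of_forall fun x => ?_)
    simp only [Real.norm_eq_abs]
    rcases lt_trichotomy (z x) 0 with hx | hx | hx
    · rw [Real.sign_of_neg hx, abs_of_neg hx, mul_neg_one]
    · simp [hx]
    · rw [Real.sign_of_pos hx, abs_of_pos hx, mul_one]
  refine ⟨l.mkContinuous ‖z‖ hl, hz, le_antisymm (l.mkContinuous_norm_le (norm_nonneg _) hl) ?_,
    -- The lower bound on the operator norm is attained at z itself; z = 0 is separate, since the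
    -- argument cancels a factor ‖z‖.
    mul_nonneg (norm_nonneg _) h⟩
  rcases (norm_nonneg z).eq_or_lt with h0 | h0
  · exact h0.ge.trans (norm_nonneg _)
  · have h1 := (l.mkContinuous ‖z‖ hl).le_opNorm z
    rw [LinearMap.mkContinuous_apply, hz, norm_pow, norm_norm, sq] at h1
    exact le_of_mul_le_mul_right h1 h0

end Duality

/-! ### Testing the equations with arctan(k(u₁ − u₂)). -/

section Accretivity

variable {d : ℕ} {Ω : Set (EuclideanSpace ℝ (Fin d))} {p q s μ : ℝ}
  {u v φ : EuclideanSpace ℝ (Fin d) → ℝ}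

theorem MemEnergy.arctan_sub [IsFiniteMeasure (volume.restrict Ω)] (hΩ : IsOpen Ω) (hp : 2 < p)
    (hq : 1 < q) (hu : MemEnergy Ω p q s μ u) (hv : MemEnergy Ω p q s μ v) (k : ℕ) :
    MemEnergy Ω p q s μ (fun x => Real.arctan (k * (u x - v x))) :=
  ⟨((hu.1.sub hΩ hp hv.1).comp hΩ hp (contDiff_arctan_mul k) (by simp)
    (norm_deriv_arctan_mul_le k)).1, fun h =>
    ((hu.2 h).sub hq (hv.2 h)).comp hq (lipschitzWith_arctan_mul k) (by simp)⟩

theorem mixedPairing_arctan_sub_nonneg [IsFiniteMeasure (volume.restrict Ω)] (hΩ : IsOpen Ω)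
    (hp : 2 < p) (hq : 1 < q) (hμ : 0 ≤ μ) (hu : MemEnergy Ω p q s μ u)
    (hv : MemEnergy Ω p q s μ v) (k : ℕ) :
    0 ≤ mixedPairing Ω p q s μ u (fun x => Real.arctan (k * (u x - v x))) -
      mixedPairing Ω p q s μ v (fun x => Real.arctan (k * (u x - v x))) := by
  have h1 := pLaplacePairing_sub_nonneg hΩ hp hu.1 hv.1 (contDiff_arctan_mul k) (by simp)
    (norm_deriv_arctan_mul_le k) (deriv_arctan_mul_nonneg k)
  have h2 : 0 ≤ μ * (fracPairing s q u (fun x => Real.arctan (k * (u x - v x))) -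
      fracPairing s q v (fun x => Real.arctan (k * (u x - v x)))) := by
    -- For μ = 0 membership in 𝒲 says nothing about W_0^{s,q}, but the factor μ removes the term.
    rcases hμ.eq_or_lt with rfl | h
    · simp
    · refine mul_nonneg hμ (fracPairing_sub_nonneg hq (hu.2 h) (hv.2 h)
        (lipschitzWith_arctan_mul k) (fun a b hab => ?_) (by simp))
      exact Real.arctan_strictMono.monotone (mul_le_mul_of_nonneg_left hab k.cast_nonneg)
  rw [mixedPairing, mixedPairing]
  linarith

theorem divPairing_sub_eq [IsFiniteMeasure (volume.restrict Ω)] (hΩ : IsOpen Ω) (hp : 2 < p)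
    (hu : MemW10 Ω p u) (hv : MemW10 Ω p v) (hφ : MemW10 Ω p φ) {f : Fin d → ℝ → ℝ}
    (hf : ∀ i, AdmissibleFlux (f i)) :
    divPairing Ω f v φ - divPairing Ω f u φ =
      ∑ i, ∫ x in Ω, (f i (u x) - f i (v x)) * weakPartial Ω i φ x := by
  have hP1 : 1 ≤ ENNReal.ofReal p := le_trans (by norm_num) (two_le_ofReal hp)
  have hi : ∀ (i : Fin d) {w : EuclideanSpace ℝ (Fin d) → ℝ}, MemW10 Ω p w →
      Integrable (fun x => f i (w x) * weakPartial Ω i φ x) (volume.restrict Ω) :=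
    fun i {w} hw => by
      obtain ⟨C, hC⟩ := (hf i).bounded
      obtain ⟨K, hK⟩ := (hf i).lipschitz
      exact ((hφ.memW1.memLp_weakPartial hΩ i).integrable hP1).bdd_mul (c := C)
        (hK.continuous.comp_aestronglyMeasurable hw.memW1.memLp.1)
        (Eventually.of_forall fun x => hC _)
  rw [divPairing, divPairing, integral_finsetSum _ fun i _ => hi i hu,
    integral_finsetSum _ fun i _ => hi i hv, neg_sub_neg, ← Finset.sum_sub_distrib]
  refine Finset.sum_congr rfl fun i _ => ?_
  rw [← integral_sub (hi i hu) (hi i hv)]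
  simp only [sub_mul]

/-- Strict monotonicity of β⁻¹ preserves all three cases of the sign; this turns the sign of u₁ −
u₂, natural for the equation, into that of v₁ − v₂, required by the duality mapping. -/
theorem sign_orderIso_symm_sub (β : ℝ ≃o ℝ) (a b : ℝ) :
    Real.sign (β.symm a - β.symm b) = Real.sign (a - b) := by
  rcases lt_trichotomy a b with h | rfl | h
  · rw [Real.sign_of_neg (sub_neg.2 h), Real.sign_of_neg (sub_neg.2 (β.symm.strictMono h))]
  · simp
  · rw [Real.sign_of_pos (sub_pos.2 h), Real.sign_of_pos (sub_pos.2 (β.symm.strictMono h))]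

theorem isAccretive_operatorGraph [IsFiniteMeasure (volume.restrict Ω)] (hΩ : IsOpen Ω)
    (hp : 2 < p) (hq : 1 < q) (hμ : 0 ≤ μ) (β : ℝ ≃o ℝ) {f : Fin d → ℝ → ℝ}
    (hf : ∀ i, AdmissibleFlux (f i)) : IsAccretive (operatorGraph Ω p q s μ β f) := by
  rintro ⟨v₁, y₁⟩ ⟨hu₁, hy₁⟩ ⟨v₂, y₂⟩ ⟨hu₂, hy₂⟩
  refine exists_duality_of_integral_sign_nonneg _ _ ?_
  dsimp only at hu₁ hu₂ hy₁ hy₂ ⊢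
  set u₁ := betaInv Ω β v₁ with hu₁_def
  set u₂ := betaInv Ω β v₂ with hu₂_def
  have hw := hu₁.1.sub hΩ hp hu₂.1
  -- Subtracting the two tested equations and discarding the nonnegative principal part leaves the
  -- flux as a lower bound.
  have hy : ∀ k : ℕ, (∑ i, ∫ x in Ω, (f i (u₁ x) - f i (u₂ x)) *
      weakPartial Ω i (fun x => Real.arctan (k * (u₁ x - u₂ x))) x) ≤
      ∫ x in Ω, (y₁ x - y₂ x) * Real.arctan (k * (u₁ x - u₂ x)) := fun k => by
    have hφ := hu₁.arctan_sub hΩ hp hq hu₂ k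
    have ma := hφ.1.memW1.memLp.1
    have hb : MemLp (fun x => Real.arctan (k * (u₁ x - u₂ x))) ⊤ (volume.restrict Ω) :=
      MemLp.of_bound ma _ (Eventually.of_forall fun x => abs_arctan_le _)
    have hi : ∀ y : Lp ℝ 1 (volume.restrict Ω), Integrable
        (fun x => y x * Real.arctan (k * (u₁ x - u₂ x))) (volume.restrict Ω) := fun y =>
      (L1.integrable_coeFn y).mul_bdd (c := Real.pi / 2) ma
        (Eventually.of_forall fun x => abs_arctan_le _)
    simp only [sub_mul (y₁ _)]
    rw [integral_sub (hi y₁) (hi y₂), ← hy₁ _ hφ hb, ← hy₂ _ hφ hb,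
      ← divPairing_sub_eq hΩ hp hu₁.1 hu₂.1 hφ.1 hf]
    have := mixedPairing_arctan_sub_nonneg hΩ hp hq hμ hu₁ hu₂ k
    linarith
  have l1 : Tendsto (fun k : ℕ => ∑ i, ∫ x in Ω, (f i (u₁ x) - f i (u₂ x)) *
      weakPartial Ω i (fun x => Real.arctan (k * (u₁ x - u₂ x))) x) atTop (𝓝 0) := by
    have := tendsto_finsetSum (Finset.univ : Finset (Fin d)) fun i _ =>
      tendsto_integral_flux_mul_weakPartial_arctan hΩ hp hu₁.1 hu₂.1
        (hf i).lipschitz.choose_spec i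
    simpa using this
  have l2 := tendsto_integral_mul_arctan
    ((L1.integrable_coeFn y₁).sub (L1.integrable_coeFn y₂)) hw.memW1.memLp.1
  have h0 := le_of_tendsto_of_tendsto l1 l2 (Eventually.of_forall hy)
  refine (nonneg_of_mul_nonneg_right h0 (by positivity)).trans (le_of_eq ?_)
  refine integral_congr_ae ?_
  filter_upwards [Lp.coeFn_sub v₁ v₂, Lp.coeFn_sub y₁ y₂,
    ae_restrict_mem hΩ.measurableSet] with x h1 h2 hx
  rw [h1, h2, Pi.sub_apply, Pi.sub_apply, hu₁_def, hu₂_def, betaInv, betaInv,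
    Set.indicator_of_mem hx, Set.indicator_of_mem hx, sign_orderIso_symm_sub]

end Accretivity

end MixedOp

theorem mainTheorem7 {d : ℕ} (hd : 1 ≤ d) (Ω : Set (EuclideanSpace ℝ (Fin d)))
    (hΩ : MixedOp.IsSmoothBoundedDomain Ω) (p q s μ α : ℝ)
    (hp : 2 < p) (hq : 1 < q) (hs₀ : 0 < s) (hs₁ : s < 1) (hμ : 0 ≤ μ)
    (hα₀ : 0 < α) (hα₁ : α ≤ 1)
    (β : ℝ ≃o ℝ) (hβ : MixedOp.AdmissibleBeta β α p)
    (f : Fin d → ℝ → ℝ) (hf : ∀ i, MixedOp.AdmissibleFlux (f i)) :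
    MixedOp.IsAccretive (MixedOp.operatorGraph Ω p q s μ β f) ∧
    ∀ u v : EuclideanSpace ℝ (Fin d) → ℝ,
      MixedOp.MemEnergy Ω p q s μ u → MixedOp.MemEnergy Ω p q s μ v → ∀ i : Fin d,
        MixedOp.MemW1 Ω p (fun x => f i (u x) - f i (v x)) ∧
        ∫ x in Ω, MixedOp.weakPartial Ω i (fun x => f i (u x) - f i (v x)) x *
          Real.sign (u x - v x) = 0 := by
  have hfin : IsFiniteMeasure (volume.restrict Ω) :=
    isFiniteMeasure_restrict.2 hΩ.isBounded.measure_lt_top.ne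
  refine ⟨MixedOp.isAccretive_operatorGraph hΩ.isOpen hp hq hμ β hf, fun u v hu hv i => ?_⟩
  obtain ⟨K, hK⟩ := (hf i).lipschitz
  exact ⟨(hu.1.memW1_comp_lipschitz hΩ.isOpen hp hK (hf i).map_zero).sub
    (hv.1.memW1_comp_lipschitz hΩ.isOpen hp hK (hf i).map_zero),
    MixedOp.integral_weakPartial_flux_mul_sign hΩ.isOpen hp hu.1 hv.1 hK (hf i).map_zero i⟩
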